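/- Let $\sigma_1,\sigma_2,\sigma_3$ be the left-invariant one-forms on $SU(2)$ with $d\sigma_1=\sigma_2\wedge\sigma_3$, $d\sigma_2=\sigma_3\wedge\sigma_1$, $d\sigma_3=\sigma_1\wedge\sigma_2$. Let $J\subset\mathbb R$ be an open interval (or any open set), let $a,b,c:J\to\mathbb R\setminus\{0\}$ and $R:J\to SO(3)$ be smooth, put $(\tilde\sigma_1,\tilde\sigma_2,\tilde\sigma_3)^T=R(t)\,(\sigma_1,\sigma_2,\sigma_3)^T$, and consider on $J\times SU(2)$ the $SU(2)$-invariant Riemannian metric $$g=(abc)^2\,dt^2+a^2\tilde\sigma_1^2+b^2\tilde\sigma_2^2+c^2\tilde\sigma_3^2 .$$ Let $J\times SU(2)$ be oriented by $\sigma_1\wedge\sigma_2\wedge\sigma_3\wedge dt$, so that the self-dual two-forms are spanned by $$bc\,\tilde\sigma_2\wedge\tilde\sigma_3+a^2bc\,\tilde\sigma_1\wedge dt,\qquad ca\,\tilde\sigma_3\wedge\tilde\sigma_1+ab^2c\,\tilde\sigma_2\wedge dt,\qquad ab\,\tilde\sigma_1\wedge\tilde\sigma_2+abc^2\,\tilde\sigma_3\wedge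 dt .$$ Write $\dot{\ }=d/dt$ and define $\xi_1,\xi_2,\xi_3$, $w_1,w_2,w_3$ and $\alpha_1,\alpha_2,\alpha_3$ by $$\dot R R^{-1}=\begin{pmatrix}0&\xi_3&-\xi_2\\-\xi_3&0&\xi_1\\ \xi_2&-\xi_1&0\end{pmatrix},\qquad w_1=bc,\quad w_2=ca,\quad w_3=ab,$$ $$\dot w_1=-w_2w_3+w_1(\alpha_2+\alpha_3),\quad \dot w_2=-w_3w_1+w_2(\alpha_3+\alpha_1),\quad \dot w_3=-w_1w_2+w_3(\alpha_1+\alpha_2).\tag{1}$$ Then $g$ is anti-self-dual (that is, $W^+=0$) with vanishing scalar curvature if and only if for every $t\in J$ and every cyclic permutation $(i,j,k)$ of $(1,2,3)$ $$\begin{aligned}\dot\alpha_i={}&-\alpha_j\alpha_k+\alpha_i(\alpha_j+\alpha_k)+\tfrac14(w_j^2-w_k^2)^2\Big(\frac{\xi_i}{w_jw_k}\Big)^2\\&+\tfrac14(w_k^2-w_i^2)(3w_i^2+w_k^2)\Big(\frac{\xi_j}{w_kw_i}\Big)^2+\tfrac14(w_j^2-w_i^2)(3w_i^2+w_j^2)\Big(\frac{\xi_k}{w_iw_j}\Big)^2\end{aligned}\tag{2}$$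 and $$\begin{aligned}(w_j^2-w_k^2)\frac{d}{dt}\Big(\frac{\xi_i}{w_jw_k}\Big)={}&\frac{\xi_j}{w_kw_i}\,\frac{\xi_k}{w_iw_j}\,\big(-2w_j^2w_k^2+w_k^2w_i^2+w_i^2w_j^2\big)\\&+\frac{\xi_i}{w_jw_k}\,\big(\alpha_jw_j^2-\alpha_kw_k^2+3\alpha_jw_k^2-3\alpha_kw_j^2\big).\end{aligned}\tag{3}$$ Moreover, $g$ is anti-self-dual with vanishing scalar curvature if and only if $A=0$ everywhere, where $A$ is the block of the curvature operator $\begin{pmatrix}A&B\\ {}^tB&D\end{pmatrix}$ on $\Lambda^2=\Lambda^+\oplus\Lambda^-$ that maps $\Lambda^+$ to $\Lambda^+$. (Equations (1), (2), (3) are nine first-order equations for the nine functions $w_i,\alpha_i,\xi_i$.) -/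

import Mathlib

open scoped Quaternion ContDiff

noncomputable section

/-! ### Curvature of a metric tensor on an open subset of a finite-dimensional real vector space

A metric tensor is a map `g : E → E →L[ℝ] E →L[ℝ] ℝ`; only its germ at `x` enters below. -/

namespace MetricTensor

variable {E : Type*} [NormedAddCommGroup E] [NormedSpace ℝ E]

/-- The trilinear form `(u, v, w) ↦ D_w g(u, v)`. -/
def derivLast (g : E → E →L[ℝ] E →L[ℝ] ℝ) (x : E) : E →L[ℝ] E →L[ℝ] E →L[ℝ] ℝ :=
  (ContinuousLinearMap.flipₗᵢ ℝ E E ℝ).toContinuousLinearEquiv.toContinuousLinearMap.comp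
    (fderiv ℝ g x).flip

/-- Raising the last index of a trilinear form by the inverse of `g x : E → E*`. -/
def raise (g : E → E →L[ℝ] E →L[ℝ] ℝ) (x : E) (T : E →L[ℝ] E →L[ℝ] E →L[ℝ] ℝ) :
    E →L[ℝ] E →L[ℝ] E :=
  (ContinuousLinearMap.compL ℝ E (E →L[ℝ] ℝ) E (g x).inverse).comp T

/-- Christoffel symbols of the Levi-Civita connection: `Γ_x(u, v) ∈ E` is determined by
`2 g(Γ(u,v), w) = D_u g(v,w) + D_v g(u,w) - D_w g(u,v)`. The connection is
`∇_X Y = DY(X) + Γ(X, Y)`. -/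
def christoffel (g : E → E →L[ℝ] E →L[ℝ] ℝ) (x : E) : E →L[ℝ] E →L[ℝ] E :=
  (1 / 2 : ℝ) • (raise g x (fderiv ℝ g x) + raise g x (fderiv ℝ g x).flip -
    raise g x (derivLast g x))

/-- The quadratic term `(u, v, w) ↦ Γ(u, Γ(v, w))` of the curvature. -/
def christoffelSq (g : E → E →L[ℝ] E →L[ℝ] ℝ) (x : E) : E →L[ℝ] E →L[ℝ] E →L[ℝ] E :=
  (ContinuousLinearMap.compL ℝ E E E).bilinearComp (christoffel g x) (christoffel g x)

/-- The Riemann curvature `R(u,v)w = ∇_u ∇_v w - ∇_v ∇_u w - ∇_[u,v] w`: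
`R(u,v)w = (D_u Γ)(v,w) - (D_v Γ)(u,w) + Γ(u,Γ(v,w)) - Γ(v,Γ(u,w))`. -/
def curvature (g : E → E →L[ℝ] E →L[ℝ] ℝ) (x : E) : E →L[ℝ] E →L[ℝ] E →L[ℝ] E :=
  fderiv ℝ (christoffel g) x - (fderiv ℝ (christoffel g) x).flip +
    christoffelSq g x - (christoffelSq g x).flip

/-- The `(0,4)` curvature `g(R(u,v)z, w)`, i.e. the curvature operator on bivectors evaluated on
`u ∧ v` and `w ∧ z`. With this convention `riemann g x u v u v` is the sectional curvature of an
orthonormal pair `u, v` (positive on round spheres). -/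
def riemann (g : E → E →L[ℝ] E →L[ℝ] ℝ) (x : E) (u v w z : E) : ℝ :=
  g x (curvature g x u v z) w

/-- The Ricci tensor `Ric(v,w) = tr (u ↦ R(u,v)w)`. -/
def ricci (g : E → E →L[ℝ] E →L[ℝ] ℝ) (x : E) : E →ₗ[ℝ] E →ₗ[ℝ] ℝ :=
  LinearMap.mk₂ ℝ
    (fun v w => LinearMap.trace ℝ E (((curvature g x).flip v).flip w : E →L[ℝ] E).toLinearMap)
    (fun v v' w => by rw [← map_add]; congr 1; ext u; simp)
    (fun r v w => by rw [← map_smul]; congr 1; ext u; simp)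
    (fun v w w' => by rw [← map_add]; congr 1; ext u; simp)
    (fun r v w => by rw [← map_smul]; congr 1; ext u; simp)

/-- The scalar curvature, the `g`-trace of the Ricci tensor. -/
def scalarCurvature [FiniteDimensional ℝ E] (g : E → E →L[ℝ] E →L[ℝ] ℝ) (x : E) : ℝ :=
  LinearMap.trace ℝ E
    ((g x).inverse.toLinearMap ∘ₗ LinearMap.toContinuousLinearMap.toLinearMap ∘ₗ ricci g x)

/-- The Weyl tensor in dimension four, as a `(0,4)` tensor in the convention of `riemann`. -/
def weyl [FiniteDimensional ℝ E] (g : E → E →L[ℝ] E →L[ℝ] ℝ) (x : E) (u v w z : E) : ℝ :=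
  riemann g x u v w z
    - (1 / 2) * (ricci g x u w * g x v z + g x u w * ricci g x v z
        - ricci g x u z * g x v w - g x u z * ricci g x v w)
    + scalarCurvature g x / 6 * (g x u w * g x v z - g x u z * g x v w)

/-- `e` is a `g`-orthonormal frame at `x` which is positive for the orientation
`θ 0 ∧ θ 1 ∧ θ 2 ∧ θ 3`. -/
def IsOrientedOrthonormalFrame (g : E → E →L[ℝ] E →L[ℝ] ℝ) (θ : Fin 4 → E →L[ℝ] ℝ) (x : E)
    (e : Fin 4 → E) : Prop :=
  (∀ i j, g x (e i) (e j) = if i = j then 1 else 0) ∧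
    0 < (Matrix.of fun i j => θ i (e j)).det

/-- `g` is anti-self-dual at `x`, i.e. `W⁺ = 0` at `x`: the Weyl tensor annihilates the self-dual
bivectors. These are spanned by the `e 0 ∧ e 1 + e 2 ∧ e 3`, where `e` runs through the oriented
orthonormal frames at `x`. -/
def IsAntiSelfDualAt [FiniteDimensional ℝ E] (g : E → E →L[ℝ] E →L[ℝ] ℝ)
    (θ : Fin 4 → E →L[ℝ] ℝ) (x : E) : Prop :=
  ∀ e : Fin 4 → E, IsOrientedOrthonormalFrame g θ x e →
    ∀ u v : E, weyl g x (e 0) (e 1) u v + weyl g x (e 2) (e 3) u v = 0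

/-- The block `A` of the curvature operator on `Λ² = Λ⁺ ⊕ Λ⁻`: its matrix on `Λ⁺` in the basis
`Ω i = f (i+1) ∧ f (i+2) + f i ∧ n` (indices mod 3), for an orthonormal frame
`f 0, f 1, f 2, n`, positive in this order. The `Ω i` have squared length 2, hence the
factor `1 / 2`. -/
def selfDualBlock (g : E → E →L[ℝ] E →L[ℝ] ℝ) (x : E) (f : Fin 3 → E) (n : E) :
    Matrix (Fin 3) (Fin 3) ℝ :=
  Matrix.of fun i j => (1 / 2) *
    (riemann g x (f (i + 1)) (f (i + 2)) (f (j + 1)) (f (j + 2))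
      + riemann g x (f (i + 1)) (f (i + 2)) (f j) n
      + riemann g x (f i) n (f (j + 1)) (f (j + 2))
      + riemann g x (f i) n (f j) n)

end MetricTensor

/-! ### `SU(2)`-invariant metrics

`SU(2)` is the group of unit quaternions, and `ℝ × SU(2)` is identified with `ℍ ∖ {0}` by the
diffeomorphism `(t, p) ↦ exp t • p`. Then `SU(2)` acts by left multiplication. -/

namespace SU2Metric

/-- The coordinate `t` on `ℍ ∖ {0} ≃ ℝ × SU(2)`. -/
def time (q : ℍ[ℝ]) : ℝ := Real.log ‖q‖

/-- The open subset `J × SU(2)` of `ℝ × SU(2) ≃ ℍ ∖ {0}`. -/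
def region (J : Set ℝ) : Set ℍ[ℝ] := {q | q ≠ 0 ∧ time q ∈ J}

/-- The one-form `dt`. -/
def dt (q : ℍ[ℝ]) : ℍ[ℝ] →L[ℝ] ℝ := fderiv ℝ time q

/-- The imaginary units `i, j, k`. -/
def unit : Fin 3 → ℍ[ℝ] := ![⟨0, 1, 0, 0⟩, ⟨0, 0, 1, 0⟩, ⟨0, 0, 0, 1⟩]

/-- The left-invariant one-forms `σ₁, σ₂, σ₃` on `SU(2)`, pulled back to `ℝ × SU(2)`:
`q⁻¹ dq = dt - (σ₁ i + σ₂ j + σ₃ k) / 2`. This normalization gives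
`dσ₁ = σ₂ ∧ σ₃`, `dσ₂ = σ₃ ∧ σ₁`, `dσ₃ = σ₁ ∧ σ₂`. -/
def sigma (i : Fin 3) (q : ℍ[ℝ]) : ℍ[ℝ] →L[ℝ] ℝ :=
  (-2 : ℝ) • (innerSL ℝ (unit i)).comp (ContinuousLinearMap.mul ℝ ℍ[ℝ] q⁻¹)

/-- The left-invariant vector fields dual to `σ₁, σ₂, σ₃` (and killed by `dt`). The vector field
`∂/∂t` is `q ↦ q`. -/
def dualField (i : Fin 3) (q : ℍ[ℝ]) : ℍ[ℝ] := (-(1 / 2) : ℝ) • (q * unit i)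

/-- The coframe `(σ₁, σ₂, σ₃, dt)`, which fixes the orientation `σ₁ ∧ σ₂ ∧ σ₃ ∧ dt`. -/
def coframe (q : ℍ[ℝ]) : Fin 4 → ℍ[ℝ] →L[ℝ] ℝ := ![sigma 0 q, sigma 1 q, sigma 2 q, dt q]

/-- The rotated forms `σ̃ = R(t) σ`. -/
def rotSigma (R : ℝ → Matrix (Fin 3) (Fin 3) ℝ) (i : Fin 3) (q : ℍ[ℝ]) : ℍ[ℝ] →L[ℝ] ℝ :=
  ∑ j, R (time q) i j • sigma j q

/-- The metric `(abc)² dt² + a² σ̃₁² + b² σ̃₂² + c² σ̃₃²`, where `a, b, c, R` are functions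
of `t`. -/
def metric (a b c : ℝ → ℝ) (R : ℝ → Matrix (Fin 3) (Fin 3) ℝ) (q : ℍ[ℝ]) :
    ℍ[ℝ] →L[ℝ] ℍ[ℝ] →L[ℝ] ℝ :=
  (a (time q) * b (time q) * c (time q)) ^ 2 • (dt q).smulRight (dt q)
    + a (time q) ^ 2 • (rotSigma R 0 q).smulRight (rotSigma R 0 q)
    + b (time q) ^ 2 • (rotSigma R 1 q).smulRight (rotSigma R 1 q)
    + c (time q) ^ 2 • (rotSigma R 2 q).smulRight (rotSigma R 2 q)

/-- The unit normal `(abc)⁻¹ ∂/∂t`, dual to `abc dt`. -/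
def normal (a b c : ℝ → ℝ) (q : ℍ[ℝ]) : ℍ[ℝ] :=
  (a (time q) * b (time q) * c (time q))⁻¹ • q

/-- The orthonormal frame of the orbits dual to `a σ̃₁, b σ̃₂, c σ̃₃` (recall that `R` is
orthogonal). -/
def orbitFrame (a b c : ℝ → ℝ) (R : ℝ → Matrix (Fin 3) (Fin 3) ℝ) (q : ℍ[ℝ]) (i : Fin 3) :
    ℍ[ℝ] :=
  ((![a, b, c] i) (time q))⁻¹ • ∑ j, R (time q) i j • dualField j q

/-- The block `A` of the curvature operator of the metric on `Λ⁺`, in the basis metrically dual to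
`bc σ̃₂∧σ̃₃ + a²bc σ̃₁∧dt`, `ca σ̃₃∧σ̃₁ + ab²c σ̃₂∧dt`, `ab σ̃₁∧σ̃₂ + abc² σ̃₃∧dt`. -/
def blockA (a b c : ℝ → ℝ) (R : ℝ → Matrix (Fin 3) (Fin 3) ℝ) (q : ℍ[ℝ]) :
    Matrix (Fin 3) (Fin 3) ℝ :=
  MetricTensor.selfDualBlock (metric a b c R) q (orbitFrame a b c R q) (normal a b c q)

/-- The matrix in `Ṙ R⁻¹ = rotationMatrix ξ₁ ξ₂ ξ₃`. -/
def rotationMatrix (x y z : ℝ) : Matrix (Fin 3) (Fin 3) ℝ :=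
  !![0, z, -y; -z, 0, x; y, -x, 0]

/-- The first equation at `t` of the system which determines `α₁, α₂, α₃`; the other two arise by
cyclic permutation of the indices. -/
def AlphaEq (w₁ w₂ w₃ α₂ α₃ : ℝ → ℝ) (t : ℝ) : Prop :=
  deriv w₁ t = -(w₂ t * w₃ t) + w₁ t * (α₂ t + α₃ t)

/-- The evolution equation of `α₁` at `t`; those of `α₂, α₃` arise by cyclic permutation. -/
def AlphaEvolution (w₁ w₂ w₃ α₁ α₂ α₃ ξ₁ ξ₂ ξ₃ : ℝ → ℝ) (t : ℝ) : Prop :=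
  deriv α₁ t = -(α₂ t * α₃ t) + α₁ t * (α₂ t + α₃ t)
    + 1 / 4 * (w₂ t ^ 2 - w₃ t ^ 2) ^ 2 * (ξ₁ t / (w₂ t * w₃ t)) ^ 2
    + 1 / 4 * (w₃ t ^ 2 - w₁ t ^ 2) * (3 * w₁ t ^ 2 + w₃ t ^ 2) * (ξ₂ t / (w₃ t * w₁ t)) ^ 2
    + 1 / 4 * (w₂ t ^ 2 - w₁ t ^ 2) * (3 * w₁ t ^ 2 + w₂ t ^ 2) * (ξ₃ t / (w₁ t * w₂ t)) ^ 2

/-- The evolution equation of `ξ₁` at `t`; those of `ξ₂, ξ₃` arise by cyclic permutation. -/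
def XiEvolution (w₁ w₂ w₃ α₂ α₃ ξ₁ ξ₂ ξ₃ : ℝ → ℝ) (t : ℝ) : Prop :=
  (w₂ t ^ 2 - w₃ t ^ 2) * deriv (fun s => ξ₁ s / (w₂ s * w₃ s)) t =
    ξ₂ t / (w₃ t * w₁ t) * (ξ₃ t / (w₁ t * w₂ t)) *
        (-2 * w₂ t ^ 2 * w₃ t ^ 2 + w₃ t ^ 2 * w₁ t ^ 2 + w₁ t ^ 2 * w₂ t ^ 2)
      + ξ₁ t / (w₂ t * w₃ t) *
        (α₂ t * w₂ t ^ 2 - α₃ t * w₃ t ^ 2 + 3 * α₂ t * w₃ t ^ 2 - 3 * α₃ t * w₂ t ^ 2)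

end SU2Metric

end

noncomputable section

namespace MetricTensor

variable {E : Type*} [NormedAddCommGroup E] [NormedSpace ℝ E]

section Christoffel

set_option maxSynthPendingDepth 5

variable {g : E → E →L[ℝ] E →L[ℝ] ℝ} {x : E}

theorem apply_raise (hx : (g x).IsInvertible) (T : E →L[ℝ] E →L[ℝ] E →L[ℝ] ℝ) (u v w : E) :
    g x (raise g x T u v) w = T u v w := by
  obtain ⟨e, he⟩ := hx
  simp [raise, ← he]

/-- The Koszul formula for coordinate vector fields. -/
theorem apply_christoffel (hx : (g x).IsInvertible) (u v w : E) :
    g x (christoffel g x u v) w =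
      1 / 2 * (fderiv ℝ g x u v w + fderiv ℝ g x v u w - fderiv ℝ g x w u v) := by
  simp [christoffel, apply_raise hx, derivLast]

theorem fderiv_symm (hg : ∀ y u v, g y u v = g y v u) (w u v : E) :
    fderiv ℝ g x w u v = fderiv ℝ g x w v u := by
  let L : (E →L[ℝ] E →L[ℝ] ℝ) ≃ₗᵢ[ℝ] (E →L[ℝ] E →L[ℝ] ℝ) :=
    ContinuousLinearMap.flipₗᵢ ℝ E E ℝ
  have h : g = L ∘ g := by
    ext y u v
    exact hg y u v
  have h' : fderiv ℝ g x = (L : (E →L[ℝ] E →L[ℝ] ℝ) →L[ℝ] _).comp (fderiv ℝ g x) := by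
    conv_lhs => rw [h]
    exact L.comp_fderiv
  conv_lhs => rw [h']
  rfl

theorem christoffel_symm (hg : ∀ y u v, g y u v = g y v u) (u v : E) :
    christoffel g x u v = christoffel g x v u := by
  have h : derivLast g x u v = derivLast g x v u := by
    ext w
    simpa [derivLast] using fderiv_symm hg w u v
  simp [christoffel, raise, h, add_comm]

theorem fderiv_christoffel_symm (hg : ∀ y u v, g y u v = g y v u) (w u v : E) :
    fderiv ℝ (christoffel g) x w u v = fderiv ℝ (christoffel g) x w v u := by
  let L : (E →L[ℝ] E →L[ℝ] E) ≃ₗᵢ[ℝ] (E →L[ℝ] E →L[ℝ] E) :=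
    ContinuousLinearMap.flipₗᵢ ℝ E E E
  have h : christoffel g = L ∘ christoffel g := by
    ext y u v
    exact christoffel_symm hg u v
  have h' : fderiv ℝ (christoffel g) x =
      (L : (E →L[ℝ] E →L[ℝ] E) →L[ℝ] _).comp (fderiv ℝ (christoffel g) x) := by
    conv_lhs => rw [h]
    exact L.comp_fderiv
  conv_lhs => rw [h']
  rfl

theorem differentiableAt_christoffel [CompleteSpace E] (hg : ContDiffAt ℝ 2 g x)
    (hx : (g x).IsInvertible) : DifferentiableAt ℝ (christoffel g) x := by
  have hd : DifferentiableAt ℝ (fderiv ℝ g) x :=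
    (hg.fderiv_right (m := 1) (by norm_num)).differentiableAt (by norm_num)
  have hi : DifferentiableAt ℝ (fun y => (g y).inverse) x := by
    obtain ⟨e, he⟩ := hx
    have h1 : ContDiffAt ℝ 2 ContinuousLinearMap.inverse (g x) := by
      rw [← he]; exact contDiffAt_map_inverse e
    exact (h1.comp x hg).differentiableAt (by norm_num)
  have hf : DifferentiableAt ℝ (fun y => (fderiv ℝ g y).flip) x :=
    (ContinuousLinearMap.flipₗᵢ ℝ E E (E →L[ℝ] ℝ)).differentiableAt.comp x hd
  have hc : DifferentiableAt ℝ
      (fun y => ContinuousLinearMap.compL ℝ E (E →L[ℝ] ℝ) E (g y).inverse) x :=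
    (ContinuousLinearMap.compL ℝ E (E →L[ℝ] ℝ) E).differentiableAt.comp x hi
  have hdl : DifferentiableAt ℝ (derivLast g) x := by
    unfold derivLast
    fun_prop
  unfold christoffel raise
  fun_prop

theorem curvature_apply (u v w : E) :
    curvature g x u v w = fderiv ℝ (christoffel g) x u v w - fderiv ℝ (christoffel g) x v u w
      + christoffel g x u (christoffel g x v w) - christoffel g x v (christoffel g x u w) := by
  simp [curvature, christoffelSq]

theorem curvature_antisymm (u v w : E) : curvature g x u v w = -curvature g x v u w := by
  simp only [curvature_apply]; abel

/-- The first Bianchi identity. -/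
theorem curvature_bianchi (hg : ∀ y u v, g y u v = g y v u) (u v w : E) :
    curvature g x u v w + curvature g x v w u + curvature g x w u v = 0 := by
  simp only [curvature_apply]
  rw [fderiv_christoffel_symm hg u w v, fderiv_christoffel_symm hg v u w,
    fderiv_christoffel_symm hg w v u, christoffel_symm hg w u, christoffel_symm hg v w,
    christoffel_symm hg u v]
  abel

/-- The covariant derivative `∇_u Y` of a vector field `Y` at `x`. -/
def covDeriv (g : E → E →L[ℝ] E →L[ℝ] ℝ) (Y : E → E) (x u : E) : E :=
  fderiv ℝ Y x u + christoffel g x u (Y x)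

theorem covDeriv_sum_smul_dir {ι : Type*} [Fintype ι] (Y : E → E) (c : ι → ℝ) (u : ι → E) :
    covDeriv g Y x (∑ i, c i • u i) = ∑ i, c i • covDeriv g Y x (u i) := by
  simp [covDeriv, Finset.sum_add_distrib]

theorem covDeriv_sum_smul {ι : Type*} [Fintype ι] {c : ι → E → ℝ} {Y : ι → E → E}
    (hc : ∀ i, DifferentiableAt ℝ (c i) x) (hY : ∀ i, DifferentiableAt ℝ (Y i) x) (u : E) :
    covDeriv g (fun y => ∑ i, c i y • Y i y) x u =
      ∑ i, (fderiv ℝ (c i) x u • Y i x + c i x • covDeriv g (Y i) x u) := by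
  have h : fderiv ℝ (fun y => ∑ i, c i y • Y i y) x u =
      ∑ i, (fderiv ℝ (c i) x u • Y i x + c i x • fderiv ℝ (Y i) x u) := by
    rw [fderiv_fun_sum (fun i _ => (hc i).fun_smul (hY i))]
    simp [fderiv_fun_smul (hc _) (hY _), add_comm]
  simp only [covDeriv, h, map_sum, map_smul, ← Finset.sum_add_distrib]
  refine Finset.sum_congr rfl fun i _ => ?_
  simp only [smul_add]; abel

/-- `R(X, Y)Z = ∇_X ∇_Y Z - ∇_Y ∇_X Z - ∇_[X, Y] Z` for vector fields `X, Y, Z`. -/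
theorem curvature_eq_covDeriv {X Y Z : E → E} (hX : DifferentiableAt ℝ X x)
    (hY : DifferentiableAt ℝ Y x) (hZ : ContDiffAt ℝ 2 Z x)
    (hΓ : DifferentiableAt ℝ (christoffel g) x) :
    curvature g x (X x) (Y x) (Z x) =
      covDeriv g (fun y => covDeriv g Z y (Y y)) x (X x)
        - covDeriv g (fun y => covDeriv g Z y (X y)) x (Y x)
        - covDeriv g Z x (fderiv ℝ Y x (X x) - fderiv ℝ X x (Y x)) := by
  have hZ1 : DifferentiableAt ℝ Z x := hZ.differentiableAt (by norm_num)
  have hZ2 : DifferentiableAt ℝ (fderiv ℝ Z) x :=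
    (hZ.fderiv_right (m := 1) (by norm_num)).differentiableAt (by norm_num)
  have hs : ∀ u v, fderiv ℝ (fderiv ℝ Z) x u v = fderiv ℝ (fderiv ℝ Z) x v u :=
    fun u v => (hZ.isSymmSndFDerivAt (by simp)).eq u v
  have key : ∀ V : E → E, DifferentiableAt ℝ V x → ∀ u,
      fderiv ℝ (fun y => covDeriv g Z y (V y)) x u =
        fderiv ℝ (fderiv ℝ Z) x u (V x) + fderiv ℝ Z x (fderiv ℝ V x u)
          + fderiv ℝ (christoffel g) x u (V x) (Z x)
          + christoffel g x (fderiv ℝ V x u) (Z x)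
          + christoffel g x (V x) (fderiv ℝ Z x u) := by
    intro V hV u
    unfold covDeriv
    rw [fderiv_fun_add (by fun_prop) (by fun_prop), fderiv_clm_apply hZ2 hV,
      fderiv_clm_apply (by fun_prop) hZ1, fderiv_clm_apply hΓ hV]
    simp only [add_apply, ContinuousLinearMap.comp_apply,
      ContinuousLinearMap.flip_apply]
    abel
  rw [covDeriv.eq_def g (fun y => covDeriv g Z y (Y y)),
    covDeriv.eq_def g (fun y => covDeriv g Z y (X y)), key Y hY, key X hX,
    curvature_apply, hs (Y x) (X x)]
  simp only [covDeriv, map_sub, map_add, sub_apply]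
  abel

end Christoffel

section OrthonormalBasis

variable {E ι : Type*} [NormedAddCommGroup E] [NormedSpace ℝ E]
  [Fintype ι] [DecidableEq ι] {B : E →L[ℝ] E →L[ℝ] ℝ} {e : ι → E}

theorem linearIndependent_of_orthonormal (he : ∀ a b, B (e a) (e b) = if a = b then 1 else 0) :
    LinearIndependent ℝ e := by
  rw [Fintype.linearIndependent_iff]
  intro c hc b
  have h := congrArg (fun v => B v (e b)) hc
  simpa [he] using h

variable [FiniteDimensional ℝ E] (hB : Fintype.card ι = Module.finrank ℝ E)

/-- The basis underlying an orthonormal frame. -/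
def frameBasis (he : ∀ a b, B (e a) (e b) = if a = b then 1 else 0)
    (hB : Fintype.card ι = Module.finrank ℝ E) : Module.Basis ι ℝ E :=
  basisOfLinearIndependentOfCardEqFinrank' e (linearIndependent_of_orthonormal he) hB

theorem frameBasis_apply (he : ∀ a b, B (e a) (e b) = if a = b then 1 else 0) (a : ι) :
    frameBasis he hB a = e a := by
  simp [frameBasis]

theorem frameBasis_repr (he : ∀ a b, B (e a) (e b) = if a = b then 1 else 0) (v : E) (a : ι) :
    (frameBasis he hB).repr v a = B v (e a) := by
  conv_rhs => rw [← (frameBasis he hB).sum_repr v]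
  simp [frameBasis_apply, he]

theorem sum_apply_smul_frame (he : ∀ a b, B (e a) (e b) = if a = b then 1 else 0)
    (hB : Fintype.card ι = Module.finrank ℝ E) (v : E) : ∑ a, B v (e a) • e a = v := by
  conv_rhs => rw [← (frameBasis he hB).sum_repr v]
  simp [frameBasis_apply, frameBasis_repr]

theorem eq_of_apply_frame (he : ∀ a b, B (e a) (e b) = if a = b then 1 else 0)
    (hB : Fintype.card ι = Module.finrank ℝ E) {v w : E} (h : ∀ a, B v (e a) = B w (e a)) :
    v = w := by
  rw [← sum_apply_smul_frame he hB v, ← sum_apply_smul_frame he hB w]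
  simp [h]

theorem isInvertible_of_orthonormal (he : ∀ a b, B (e a) (e b) = if a = b then 1 else 0)
    (hB : Fintype.card ι = Module.finrank ℝ E) : B.IsInvertible := by
  have hinj : Function.Injective B.toLinearMap := by
    intro v w h
    refine eq_of_apply_frame he hB fun a => ?_
    exact congrArg (fun f : E →L[ℝ] ℝ => f (e a)) h
  have hrank : Module.finrank ℝ E = Module.finrank ℝ (E →L[ℝ] ℝ) := by
    rw [← (LinearMap.toContinuousLinearMap (𝕜 := ℝ) (E := E) (F' := ℝ)).finrank_eq]
    exact (Subspace.dual_finrank_eq (K := ℝ) (V := E)).symm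
  exact ⟨(B.toLinearMap.linearEquivOfInjective hinj hrank).toContinuousLinearEquiv, rfl⟩

theorem trace_eq_sum_frame (he : ∀ a b, B (e a) (e b) = if a = b then 1 else 0)
    (hB : Fintype.card ι = Module.finrank ℝ E) (L : E →ₗ[ℝ] E) :
    LinearMap.trace ℝ E L = ∑ a, B (L (e a)) (e a) := by
  rw [LinearMap.trace_eq_matrix_trace ℝ (frameBasis he hB), Matrix.trace]
  simp [LinearMap.toMatrix_apply, frameBasis_repr, frameBasis_apply]

end OrthonormalBasis

section Frame

variable {E ι : Type*} [NormedAddCommGroup E] [NormedSpace ℝ E] [FiniteDimensional ℝ E]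
  [Fintype ι] [DecidableEq ι] {g : E → E →L[ℝ] E →L[ℝ] ℝ} {e : ι → E → E} {x : E}

theorem ricci_eq_sum_frame (he : ∀ a b, g x (e a x) (e b x) = if a = b then 1 else 0)
    (hE : Fintype.card ι = Module.finrank ℝ E) (v w : E) :
    ricci g x v w = ∑ a, riemann g x (e a x) v (e a x) w := by
  change LinearMap.trace ℝ E _ = _
  rw [trace_eq_sum_frame he hE]
  rfl

theorem scalarCurvature_eq_sum_frame
    (he : ∀ a b, g x (e a x) (e b x) = if a = b then 1 else 0)
    (hE : Fintype.card ι = Module.finrank ℝ E) :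
    scalarCurvature g x = ∑ a, ricci g x (e a x) (e a x) := by
  rw [scalarCurvature, trace_eq_sum_frame he hE]
  obtain ⟨L, hL⟩ := isInvertible_of_orthonormal he hE
  refine Finset.sum_congr rfl fun a _ => ?_
  simp [← hL]

/-- The Levi-Civita connection coefficients `g(∇_a e_b, e_c)` of an orthonormal frame with
structure functions `C a b c = g([e_a, e_b], e_c)`. -/
def connectionCoeff (C : ι → ι → ι → E → ℝ) (a b c : ι) (y : E) : ℝ :=
  1 / 2 * (C a b c y - C a c b y - C b c a y)

variable {C : ι → ι → ι → E → ℝ}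

/-- The Koszul formula in an orthonormal frame. -/
theorem covDeriv_frame (hg : ∀ y u v, g y u v = g y v u) (hgx : DifferentiableAt ℝ g x)
    (he : ∀ᶠ y in nhds x, ∀ a b, g y (e a y) (e b y) = if a = b then 1 else 0)
    (hE : Fintype.card ι = Module.finrank ℝ E) (hex : ∀ a, DifferentiableAt ℝ (e a) x)
    (hC : ∀ a b, fderiv ℝ (e b) x (e a x) - fderiv ℝ (e a) x (e b x) = ∑ c, C a b c x • e c x)
    (a b : ι) :
    covDeriv g (e b) x (e a x) = ∑ c, connectionCoeff C a b c x • e c x := by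
  have hex0 := he.self_of_nhds
  have hC' : ∀ a b c, g x (fderiv ℝ (e b) x (e a x)) (e c x)
      - g x (fderiv ℝ (e a) x (e b x)) (e c x) = C a b c x := by
    intro a b c
    have := congrArg (fun v => g x v (e c x)) (hC a b)
    simpa [hex0] using this
  have hd : ∀ u b c, fderiv ℝ g x u (e b x) (e c x) =
      -(g x (fderiv ℝ (e b) x u) (e c x)) - g x (fderiv ℝ (e c) x u) (e b x) := by
    intro u b c
    have h0 : fderiv ℝ (fun y => g y (e b y) (e c y)) x u = 0 := by
      have : (fun y => g y (e b y) (e c y)) =ᶠ[nhds x] fun _ => if b = c then 1 else 0 := by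
        filter_upwards [he] with y hy using hy b c
      rw [this.fderiv_eq]; simp
    rw [fderiv_clm_apply (hgx.clm_apply (hex b)) (hex c),
      fderiv_clm_apply hgx (hex b)] at h0
    simp only [add_apply, ContinuousLinearMap.comp_apply,
      ContinuousLinearMap.flip_apply] at h0
    rw [hg x (fderiv ℝ (e c) x u)]
    linarith
  refine eq_of_apply_frame hex0 hE fun c => ?_
  have h1 : g x (∑ c, connectionCoeff C a b c x • e c x) (e c x) = connectionCoeff C a b c x := by
    simp [hex0]
  rw [h1, covDeriv, map_add, add_apply,
    apply_christoffel (isInvertible_of_orthonormal hex0 hE), hd, hd, hd, connectionCoeff,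
    ← hC', ← hC', ← hC']
  ring

/-- The structure equation in an orthonormal frame. -/
theorem riemann_frame {U : Set E} (hU : IsOpen U) (hx : x ∈ U)
    (hg : ∀ y u v, g y u v = g y v u) (hgU : ContDiffOn ℝ 2 g U)
    (he : ∀ y ∈ U, ∀ a b, g y (e a y) (e b y) = if a = b then 1 else 0)
    (hE : Fintype.card ι = Module.finrank ℝ E) (heU : ∀ a, ContDiffOn ℝ 2 (e a) U)
    (hC : ∀ y ∈ U, ∀ a b,
      fderiv ℝ (e b) y (e a y) - fderiv ℝ (e a) y (e b y) = ∑ c, C a b c y • e c y)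
    (hCU : ∀ a b c, DifferentiableAt ℝ (C a b c) x) (a b c d : ι) :
    riemann g x (e a x) (e b x) (e d x) (e c x) =
      fderiv ℝ (connectionCoeff C b c d) x (e a x) - fderiv ℝ (connectionCoeff C a c d) x (e b x)
      + ∑ m, (connectionCoeff C b c m x * connectionCoeff C a m d x
        - connectionCoeff C a c m x * connectionCoeff C b m d x
        - C a b m x * connectionCoeff C m c d x) := by
  have hgy : ∀ y ∈ U, ContDiffAt ℝ 2 g y := fun y hy => hgU.contDiffAt (hU.mem_nhds hy)
  have hey : ∀ y ∈ U, ∀ a, ContDiffAt ℝ 2 (e a) y :=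
    fun y hy a => (heU a).contDiffAt (hU.mem_nhds hy)
  have hed : ∀ a, DifferentiableAt ℝ (e a) x := fun a => (hey x hx a).differentiableAt (by norm_num)
  have hcov : ∀ y ∈ U, ∀ a b,
      covDeriv g (e b) y (e a y) = ∑ c, connectionCoeff C a b c y • e c y := fun y hy =>
    covDeriv_frame hg ((hgy y hy).differentiableAt (by norm_num))
      (Filter.eventually_of_mem (hU.mem_nhds hy) he) hE
      (fun a => (hey y hy a).differentiableAt (by norm_num)) (hC y hy)
  have hG : ∀ a b c, DifferentiableAt ℝ (connectionCoeff C a b c) x := by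
    intro a b c
    unfold connectionCoeff
    have := hCU a b c
    have := hCU a c b
    have := hCU b c a
    fun_prop
  have hcc : ∀ a b u, covDeriv g (fun y => covDeriv g (e b) y (e a y)) x u =
      ∑ c, (fderiv ℝ (connectionCoeff C a b c) x u • e c x
        + connectionCoeff C a b c x • covDeriv g (e c) x u) := by
    intro a b u
    have heq : (fun y => covDeriv g (e b) y (e a y)) =ᶠ[nhds x]
        fun y => ∑ c, connectionCoeff C a b c y • e c y :=
      Filter.eventually_of_mem (hU.mem_nhds hx) fun y hy => hcov y hy a b
    rw [← covDeriv_sum_smul (hG a b) hed]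
    simp only [covDeriv.eq_def g (fun y => covDeriv g (e b) y (e a y)),
      covDeriv.eq_def g (fun y => ∑ c, connectionCoeff C a b c y • e c y),
      heq.fderiv_eq, heq.self_of_nhds]
  rw [riemann, curvature_eq_covDeriv (hed a) (hed b) (hey x hx c)
    (differentiableAt_christoffel (hgy x hx) (isInvertible_of_orthonormal (he x hx) hE)),
    hcc, hcc, hC x hx, covDeriv_sum_smul_dir]
  simp only [hcov x hx, map_sub, map_sum, map_add, map_smul, sub_apply, sum_apply, add_apply,
    smul_apply, he x hx, Finset.sum_add_distrib, smul_eq_mul, mul_ite, mul_one, mul_zero,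
    Finset.sum_ite_eq', Finset.mem_univ, if_true, Finset.sum_sub_distrib]
  ring

end Frame

section Algebra

/-- The components of an algebraic curvature tensor, in the convention of `riemann`. -/
structure IsAlgebraicCurvature {ι : Type*} (S : ι → ι → ι → ι → ℝ) : Prop where
  antisymm_left : ∀ a b c d, S a b c d = -S b a c d
  antisymm_right : ∀ a b c d, S a b c d = -S a b d c
  bianchi : ∀ a b c d, S a b c d + S b d c a + S d a c b = 0

theorem IsAlgebraicCurvature.pair_symm {ι : Type*} {S : ι → ι → ι → ι → ℝ}
    (hS : IsAlgebraicCurvature S) (a b c d : ι) : S a b c d = S c d a b := by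
  have h1 := hS.antisymm_left
  have h2 := hS.antisymm_right
  have h3 := hS.bianchi
  linarith [h3 a b c d, h3 b c d a, h3 c d a b, h3 d a b c,
    h1 b d c a, h1 d a c b, h2 d b c a, h1 c a d b, h1 a b d c, h2 b a c d,
    h2 d b a c, h1 d b a c, h1 b c a d, h2 c b a d, h1 a c b d, h2 c a b d, h1 c d b a, h2 d c b a,
    h2 b c d a, h1 d c a b, h2 a b c d, h2 c d a b, h2 d a b c, h2 a d b c, h1 a d b c, h2 b d c a]

/-- The Ricci contraction. -/
def ricciComp (S : Fin 4 → Fin 4 → Fin 4 → Fin 4 → ℝ) (b d : Fin 4) : ℝ := ∑ a, S a b a d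

/-- The scalar contraction. -/
def scalarComp (S : Fin 4 → Fin 4 → Fin 4 → Fin 4 → ℝ) : ℝ := ∑ b, ricciComp S b b

/-- The components of the Weyl tensor in an orthonormal frame. -/
def weylComp (S : Fin 4 → Fin 4 → Fin 4 → Fin 4 → ℝ) (a b c d : Fin 4) : ℝ :=
  S a b c d
    - (1 / 2) * (ricciComp S a c * (if b = d then 1 else 0)
        + (if a = c then 1 else 0) * ricciComp S b d
        - ricciComp S a d * (if b = c then 1 else 0)
        - (if a = d then 1 else 0) * ricciComp S b c)
    + scalarComp S / 6 * ((if a = c then 1 else 0) * (if b = d then 1 else 0)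
        - (if a = d then 1 else 0) * (if b = c then 1 else 0))

/-- The evaluation of a `(0,4)` tensor on a self-dual bivector. -/
def selfDualPart (S : Fin 4 → Fin 4 → Fin 4 → Fin 4 → ℝ) (i : Fin 3) (c d : Fin 4) : ℝ :=
  S (i + 1).castSucc (i + 2).castSucc c d + S i.castSucc 3 c d

/-- The matrix of an algebraic curvature tensor on self-dual bivectors. -/
def selfDualComp (S : Fin 4 → Fin 4 → Fin 4 → Fin 4 → ℝ) (i j : Fin 3) : ℝ :=
  selfDualPart S i (j + 1).castSucc (j + 2).castSucc + selfDualPart S i j.castSucc 3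

variable {S : Fin 4 → Fin 4 → Fin 4 → Fin 4 → ℝ}

theorem IsAlgebraicCurvature.components (hS : IsAlgebraicCurvature S) :
    (∀ a c d, S a a c d = 0) ∧ (∀ a b c, S a b c c = 0) ∧
    (∀ c d, S 1 0 c d = -S 0 1 c d) ∧ (∀ c d, S 2 0 c d = -S 0 2 c d) ∧
    (∀ c d, S 3 0 c d = -S 0 3 c d) ∧ (∀ c d, S 2 1 c d = -S 1 2 c d) ∧
    (∀ c d, S 3 1 c d = -S 1 3 c d) ∧ (∀ c d, S 3 2 c d = -S 2 3 c d) ∧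
    (∀ a b, S a b 1 0 = -S a b 0 1) ∧ (∀ a b, S a b 2 0 = -S a b 0 2) ∧
    (∀ a b, S a b 3 0 = -S a b 0 3) ∧ (∀ a b, S a b 2 1 = -S a b 1 2) ∧
    (∀ a b, S a b 3 1 = -S a b 1 3) ∧ (∀ a b, S a b 3 2 = -S a b 2 3) := by
  refine ⟨fun a c d => ?_, fun a b c => ?_, ?_⟩
  · linarith [hS.antisymm_left a a c d]
  · linarith [hS.antisymm_right a b c c]
  · exact ⟨hS.antisymm_left 1 0, hS.antisymm_left 2 0, hS.antisymm_left 3 0,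
      hS.antisymm_left 2 1, hS.antisymm_left 3 1, hS.antisymm_left 3 2,
      fun a b => hS.antisymm_right a b 1 0, fun a b => hS.antisymm_right a b 2 0,
      fun a b => hS.antisymm_right a b 3 0, fun a b => hS.antisymm_right a b 2 1,
      fun a b => hS.antisymm_right a b 3 1, fun a b => hS.antisymm_right a b 3 2⟩

theorem IsAlgebraicCurvature.pairs (hS : IsAlgebraicCurvature S) :
    S 0 2 0 1 = S 0 1 0 2 ∧ S 0 3 0 1 = S 0 1 0 3 ∧ S 1 2 0 1 = S 0 1 1 2 ∧
    S 1 3 0 1 = S 0 1 1 3 ∧ S 2 3 0 1 = S 0 1 2 3 ∧ S 0 3 0 2 = S 0 2 0 3 ∧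
    S 1 2 0 2 = S 0 2 1 2 ∧ S 1 3 0 2 = S 0 2 1 3 ∧ S 2 3 0 2 = S 0 2 2 3 ∧
    S 1 2 0 3 = S 0 3 1 2 ∧ S 1 3 0 3 = S 0 3 1 3 ∧ S 2 3 0 3 = S 0 3 2 3 ∧
    S 1 3 1 2 = S 1 2 1 3 ∧ S 2 3 1 2 = S 1 2 2 3 ∧ S 2 3 1 3 = S 1 3 2 3 :=
  ⟨hS.pair_symm .., hS.pair_symm .., hS.pair_symm .., hS.pair_symm .., hS.pair_symm ..,
    hS.pair_symm .., hS.pair_symm .., hS.pair_symm .., hS.pair_symm .., hS.pair_symm ..,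
    hS.pair_symm .., hS.pair_symm .., hS.pair_symm .., hS.pair_symm .., hS.pair_symm ..⟩

theorem IsAlgebraicCurvature.selfDualComp_weylComp (hS : IsAlgebraicCurvature S) (i j : Fin 3) :
    selfDualComp (weylComp S) i j = selfDualComp S i j
      - (if i = j then scalarComp S / 6 else 0) := by
  obtain ⟨z1, z2, a1, a2, a3, a4, a5, a6, b1, b2, b3, b4, b5, b6⟩ := hS.components
  obtain ⟨p1, p2, p3, p4, p5, p6, p7, p8, p9, p10, p11, p12, p13, p14, p15⟩ := hS.pairs
  have d1 : Fin.castSucc (0 : Fin 3) = (0 : Fin 4) := rfl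
  have d2 : Fin.castSucc (1 : Fin 3) = (1 : Fin 4) := rfl
  have d3 : Fin.castSucc (2 : Fin 3) = (2 : Fin 4) := rfl
  fin_cases i <;> fin_cases j <;>
    simp [selfDualComp, selfDualPart, weylComp, scalarComp, ricciComp, Fin.sum_univ_four,
      z1, z2, a1, a2, a3, a4, a5, a6, b1, b2, b3, b4, b5, b6, d1, d2, d3,
      p1, p2, p3, p4, p5, p6, p7, p8, p9, p10, p11, p12, p13, p14, p15] <;> ring

theorem IsAlgebraicCurvature.scalarComp_eq (hS : IsAlgebraicCurvature S) :
    scalarComp S = 2 * ∑ i, selfDualComp S i i := by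
  obtain ⟨z1, z2, a1, a2, a3, a4, a5, a6, b1, b2, b3, b4, b5, b6⟩ := hS.components
  obtain ⟨-, -, -, -, p5, -, -, p8, -, p10, -⟩ := hS.pairs
  have d1 : Fin.castSucc (0 : Fin 3) = (0 : Fin 4) := rfl
  have d2 : Fin.castSucc (1 : Fin 3) = (1 : Fin 4) := rfl
  have d3 : Fin.castSucc (2 : Fin 3) = (2 : Fin 4) := rfl
  have h := hS.bianchi 0 1 2 3
  simp [selfDualComp, selfDualPart, scalarComp, ricciComp, Fin.sum_univ_four, Fin.sum_univ_three,
      z1, a1, a2, a3, a4, a5, a6, b1, b2, b3, b4, b5, b6, d1, d2, d3, p5, p8, p10] at h ⊢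
  linarith

/-- The Weyl tensor maps self-dual bivectors to self-dual ones. -/
theorem IsAlgebraicCurvature.selfDualPart_weylComp (hS : IsAlgebraicCurvature S) (i j : Fin 3) :
    selfDualPart (weylComp S) i (j + 1).castSucc (j + 2).castSucc =
      selfDualPart (weylComp S) i j.castSucc 3 := by
  obtain ⟨z1, z2, a1, a2, a3, a4, a5, a6, b1, b2, b3, b4, b5, b6⟩ := hS.components
  obtain ⟨p1, p2, p3, p4, p5, p6, p7, p8, p9, p10, p11, p12, p13, p14, p15⟩ := hS.pairs
  have d1 : Fin.castSucc (0 : Fin 3) = (0 : Fin 4) := rfl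
  have d2 : Fin.castSucc (1 : Fin 3) = (1 : Fin 4) := rfl
  have d3 : Fin.castSucc (2 : Fin 3) = (2 : Fin 4) := rfl
  fin_cases i <;> fin_cases j <;>
    simp [selfDualPart, weylComp, scalarComp, ricciComp, Fin.sum_univ_four,
      z1, z2, a1, a2, a3, a4, a5, a6, b1, b2, b3, b4, b5, b6, d1, d2, d3,
      p1, p2, p3, p4, p5, p6, p7, p8, p9, p10, p11, p12, p13, p14, p15] <;> ring

end Algebra

section Minors

theorem minor_eq_complementary_minor {M : Matrix (Fin 4) (Fin 4) ℝ} (h : M * M.transpose = 1)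
    (hd : M.det = 1) :
    M 0 0 * M 1 1 - M 0 1 * M 1 0 = M 2 2 * M 3 3 - M 2 3 * M 3 2 := by
  have e : ∀ i j, M i 0 * M j 0 + M i 1 * M j 1 + M i 2 * M j 2 + M i 3 * M j 3 =
      if i = j then 1 else 0 := by
    intro i j
    have := congrFun (congrFun h i) j
    rw [Matrix.mul_apply, Fin.sum_univ_four] at this
    simpa [Matrix.one_apply] using this
  have hp : M * !![1, 0, M 2 0, M 3 0; 0, 1, M 2 1, M 3 1; 0, 0, M 2 2, M 3 2;
      0, 0, M 2 3, M 3 3] = !![M 0 0, M 0 1, 0, 0; M 1 0, M 1 1, 0, 0; M 2 0, M 2 1, 1, 0;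
      M 3 0, M 3 1, 0, 1] := by
    ext i j
    rw [Matrix.mul_apply, Fin.sum_univ_four]
    fin_cases i <;> fin_cases j <;> simp [e]
  have hdet := congrArg Matrix.det hp
  rw [Matrix.det_mul, hd, one_mul] at hdet
  simp [Matrix.det_succ_row_zero, Fin.sum_univ_succ, Fin.succAbove] at hdet
  linarith

theorem minor_eq_complementary_minor_perm {M : Matrix (Fin 4) (Fin 4) ℝ}
    (h : M * M.transpose = 1) (hd : M.det = 1) (r : Equiv.Perm (Fin 4))
    (hr : Equiv.Perm.sign r = 1) :
    M (r 0) 0 * M (r 1) 1 - M (r 0) 1 * M (r 1) 0 =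
      M (r 2) 2 * M (r 3) 3 - M (r 2) 3 * M (r 3) 2 := by
  refine minor_eq_complementary_minor (M := M.submatrix r id) ?_ ?_
  · have := Matrix.submatrix_mul_equiv M M.transpose r (Equiv.refl _) r
    rw [h, Matrix.submatrix_one_equiv] at this
    exact this
  · rw [Matrix.det_permute, hr, hd]; simp

end Minors

section AntiSelfDual

variable {E : Type*} [NormedAddCommGroup E] [NormedSpace ℝ E]
  {g : E → E →L[ℝ] E →L[ℝ] ℝ} {x : E} {e : Fin 4 → E → E} {θ : Fin 4 → E →L[ℝ] ℝ}

/-- The components of the curvature in the frame `e`. -/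
def riemannComp (g : E → E →L[ℝ] E →L[ℝ] ℝ) (e : Fin 4 → E → E) (x : E) (a b c d : Fin 4) : ℝ :=
  riemann g x (e a x) (e b x) (e c x) (e d x)

theorem selfDualBlock_eq_zero_iff :
    selfDualBlock g x (fun i => e i.castSucc x) (e 3 x) = 0 ↔
      ∀ i j, selfDualComp (riemannComp g e x) i j = 0 := by
  rw [← Matrix.ext_iff]
  refine forall_congr' fun i => forall_congr' fun j => ?_
  simp only [selfDualBlock, selfDualComp, selfDualPart, riemannComp, Matrix.of_apply,
    Matrix.zero_apply]
  constructor <;> intro h <;> linarith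

variable [FiniteDimensional ℝ E]

theorem weyl_frame (he : ∀ a b, g x (e a x) (e b x) = if a = b then 1 else 0)
    (hE : Module.finrank ℝ E = 4) (a b c d : Fin 4) :
    weyl g x (e a x) (e b x) (e c x) (e d x) = weylComp (riemannComp g e x) a b c d := by
  have hcard : Fintype.card (Fin 4) = Module.finrank ℝ E := by simp [hE]
  have hr : ∀ a b, ricci g x (e a x) (e b x) = ricciComp (riemannComp g e x) a b := fun a b =>
    ricci_eq_sum_frame he hcard _ _
  have hs : scalarCurvature g x = scalarComp (riemannComp g e x) := by
    rw [scalarCurvature_eq_sum_frame he hcard]; simp only [hr]; rfl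
  simp only [weyl, weylComp, hr, hs, he]
  rfl

/-- The Weyl tensor as a multilinear form. -/
theorem weyl_sum (c₁ c₂ c₃ c₄ : Fin 4 → ℝ) (u : Fin 4 → E) :
    weyl g x (∑ i, c₁ i • u i) (∑ i, c₂ i • u i) (∑ i, c₃ i • u i) (∑ i, c₄ i • u i) =
      ∑ l, ∑ k, c₃ k * c₄ l * ∑ j, ∑ i, c₁ i * c₂ j * weyl g x (u i) (u j) (u k) (u l) := by
  have h1 : ∀ v w z, weyl g x (∑ i, c₁ i • u i) v w z = ∑ i, c₁ i * weyl g x (u i) v w z := by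
    intro v w z
    simp only [weyl, riemann, Fin.sum_univ_four, map_add, map_smul, add_apply, smul_apply,
      LinearMap.add_apply, LinearMap.smul_apply, smul_eq_mul]
    ring
  have h2 : ∀ v w z, weyl g x v (∑ i, c₂ i • u i) w z = ∑ i, c₂ i * weyl g x v (u i) w z := by
    intro v w z
    simp only [weyl, riemann, Fin.sum_univ_four, map_add, map_smul, add_apply, smul_apply,
      LinearMap.add_apply, LinearMap.smul_apply, smul_eq_mul]
    ring
  have h3 : ∀ v w z, weyl g x v w (∑ i, c₃ i • u i) z = ∑ i, c₃ i * weyl g x v w (u i) z := by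
    intro v w z
    simp only [weyl, riemann, Fin.sum_univ_four, map_add, map_smul, smul_eq_mul]
    ring
  have h4 : ∀ v w z, weyl g x v w z (∑ i, c₄ i • u i) = ∑ i, c₄ i * weyl g x v w z (u i) := by
    intro v w z
    simp only [weyl, riemann, Fin.sum_univ_four, map_add, map_smul, add_apply, smul_apply,
      smul_eq_mul]
    ring
  rw [h4]
  refine Finset.sum_congr rfl fun l _ => ?_
  rw [h3, Finset.mul_sum]
  refine Finset.sum_congr rfl fun k _ => ?_
  rw [h2, ← mul_assoc, mul_comm (c₄ l)]
  congr 1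
  refine Finset.sum_congr rfl fun j _ => ?_
  rw [h1, Finset.mul_sum]
  refine Finset.sum_congr rfl fun i _ => ?_
  ring

theorem weylComp_antisymm_left {S : Fin 4 → Fin 4 → Fin 4 → Fin 4 → ℝ}
    (hS : IsAlgebraicCurvature S) (a b c d : Fin 4) : weylComp S a b c d = -weylComp S b a c d := by
  rw [weylComp, hS.antisymm_left, weylComp]; ring

theorem weylComp_antisymm_right {S : Fin 4 → Fin 4 → Fin 4 → Fin 4 → ℝ}
    (hS : IsAlgebraicCurvature S) (a b c d : Fin 4) : weylComp S a b c d = -weylComp S a b d c := by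
  rw [weylComp, hS.antisymm_right, weylComp]; ring

/-- If the curvature operator kills the self-dual bivectors of one oriented orthonormal frame, then
the Weyl tensor kills those of every such frame. -/
theorem isAntiSelfDualAt_of_selfDualPart
    (he : ∀ a b, g x (e a x) (e b x) = if a = b then 1 else 0)
    (hE : Module.finrank ℝ E = 4) (hθ : 0 < (Matrix.of fun i j => θ i (e j x)).det)
    (hS : IsAlgebraicCurvature (riemannComp g e x))
    (hW : ∀ i c d, selfDualPart (weylComp (riemannComp g e x)) i c d = 0) :
    IsAntiSelfDualAt g θ x := by
  intro f hf u v
  obtain ⟨hf1, hf2⟩ := hf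
  have hcard : Fintype.card (Fin 4) = Module.finrank ℝ E := by simp [hE]
  let M : Matrix (Fin 4) (Fin 4) ℝ := Matrix.of fun k j => g x (f j) (e k x)
  have hexp : ∀ w, w = ∑ k, g x w (e k x) • e k x := fun w => (sum_apply_smul_frame he hcard w).symm
  have hfexp : ∀ j, f j = ∑ k, M k j • e k x := fun j => hexp (f j)
  have hMM : M.transpose * M = 1 := by
    ext i j
    rw [Matrix.one_apply, ← hf1 i j]
    conv_rhs => rw [hfexp j]
    simp [Matrix.mul_apply, M, mul_comm]
  have hdet : M.det = 1 := by
    have h1 : M.det * M.det = 1 := by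
      have := congrArg Matrix.det hMM
      simpa [Matrix.det_mul] using this
    have h2 : (Matrix.of fun i j => θ i (f j)) = (Matrix.of fun i j => θ i (e j x)) * M := by
      ext i j
      rw [Matrix.mul_apply, Matrix.of_apply, hfexp j]
      simp [mul_comm]
    rw [h2, Matrix.det_mul] at hf2
    have h3 : 0 < M.det := pos_of_mul_pos_right hf2 hθ.le
    nlinarith
  have hMM' : M * M.transpose = 1 := mul_eq_one_comm.mp hMM
  have m : ∀ r : Equiv.Perm (Fin 4), Equiv.Perm.sign r = 1 → _ :=
    fun r => minor_eq_complementary_minor_perm hMM' hdet r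
  have m1 : M 0 0 * M 1 1 - M 0 1 * M 1 0 = M 2 2 * M 3 3 - M 2 3 * M 3 2 := m 1 (by simp)
  have m2 : M 2 0 * M 3 1 - M 2 1 * M 3 0 = M 0 2 * M 1 3 - M 0 3 * M 1 2 :=
    m (Equiv.swap 0 2 * Equiv.swap 1 3) (by decide)
  have m3 : M 1 0 * M 2 1 - M 1 1 * M 2 0 = M 0 2 * M 3 3 - M 0 3 * M 3 2 :=
    m (Equiv.swap 0 1 * Equiv.swap 1 2) (by decide)
  have m4 : M 0 0 * M 3 1 - M 0 1 * M 3 0 = M 1 2 * M 2 3 - M 1 3 * M 2 2 :=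
    m (Equiv.swap 1 3 * Equiv.swap 2 3) (by decide)
  have m5 : M 2 0 * M 0 1 - M 2 1 * M 0 0 = M 1 2 * M 3 3 - M 1 3 * M 3 2 :=
    m (Equiv.swap 1 2 * Equiv.swap 0 1) (by decide)
  have m6 : M 1 0 * M 3 1 - M 1 1 * M 3 0 = M 2 2 * M 0 3 - M 2 3 * M 0 2 :=
    m (Equiv.swap 0 3 * Equiv.swap 0 1) (by decide)
  rw [hfexp 0, hfexp 1, hfexp 2, hfexp 3, hexp u, hexp v, weyl_sum, weyl_sum,
    ← Finset.sum_add_distrib]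
  refine Finset.sum_eq_zero fun l _ => ?_
  rw [← Finset.sum_add_distrib]
  refine Finset.sum_eq_zero fun k _ => ?_
  rw [← mul_add]
  refine mul_eq_zero_of_right _ ?_
  simp only [weyl_frame he hE]
  set W := weylComp (riemannComp g e x) with hWdef
  have ha : ∀ a b, W a b k l = -W b a k l := fun a b => weylComp_antisymm_left hS a b k l
  have w0 : W 1 2 k l + W 0 3 k l = 0 := hW 0 k l
  have w1 : W 2 0 k l + W 1 3 k l = 0 := hW 1 k l
  have w2 : W 0 1 k l + W 2 3 k l = 0 := hW 2 k l
  have z : ∀ a, W a a k l = 0 := fun a => by linarith [ha a a]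
  simp only [Fin.sum_univ_four, z, ha 1 0, ha 2 1, ha 0 2, ha 3 0, ha 3 1, ha 3 2,
    eq_neg_of_add_eq_zero_left w0, eq_neg_of_add_eq_zero_left w1, eq_neg_of_add_eq_zero_left w2]
  linear_combination (-W 2 3 k l) * (m1 - m2) - W 0 3 k l * (m3 - m4) - W 1 3 k l * (m5 - m6)

theorem forall_eq_zero_of_selfDualPart_pairs {T : Fin 4 → Fin 4 → ℝ} (ha : ∀ c d, T c d = -T d c)
    (h1 : ∀ j : Fin 3, T (j + 1).castSucc (j + 2).castSucc = 0)
    (h2 : ∀ j : Fin 3, T j.castSucc 3 = 0) (c d : Fin 4) : T c d = 0 := by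
  have z : ∀ a, T a a = 0 := fun a => by linarith [ha a a]
  have e1 : T 1 2 = 0 := h1 0
  have e2 : T 2 0 = 0 := h1 1
  have e3 : T 0 1 = 0 := h1 2
  have e4 : T 0 3 = 0 := h2 0
  have e5 : T 1 3 = 0 := h2 1
  have e6 : T 2 3 = 0 := h2 2
  fin_cases c <;> fin_cases d <;>
    simp [z, e1, e2, e3, e4, e5, e6, ha 2 1, ha 0 2, ha 1 0, ha 3 0, ha 3 1, ha 3 2]

theorem selfDualPart_eq_zero_of_perm {W : Fin 4 → Fin 4 → Fin 4 → Fin 4 → ℝ}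
    (h : ∀ r : Equiv.Perm (Fin 4), Equiv.Perm.sign r = 1 → ∀ c d,
      W (r 0) (r 1) c d + W (r 2) (r 3) c d = 0) (i : Fin 3) (c d : Fin 4) :
    selfDualPart W i c d = 0 := by
  fin_cases i
  · exact h (Equiv.swap 0 1 * Equiv.swap 1 2) (by decide) c d
  · exact h (Equiv.swap 1 2 * Equiv.swap 0 1) (by decide) c d
  · exact h 1 (by simp) c d

/-- A metric is anti-self-dual and scalar-flat at `x` if and only if the block `A` of its curvature
operator vanishes there. -/
theorem isAntiSelfDualAt_and_scalarFlat_iff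
    (he : ∀ a b, g x (e a x) (e b x) = if a = b then 1 else 0)
    (hE : Module.finrank ℝ E = 4) (hθ : 0 < (Matrix.of fun i j => θ i (e j x)).det)
    (hS : IsAlgebraicCurvature (riemannComp g e x)) :
    (IsAntiSelfDualAt g θ x ∧ scalarCurvature g x = 0) ↔
      selfDualBlock g x (fun i => e i.castSucc x) (e 3 x) = 0 := by
  have hcard : Fintype.card (Fin 4) = Module.finrank ℝ E := by simp [hE]
  have hs : scalarCurvature g x = scalarComp (riemannComp g e x) := by
    rw [scalarCurvature_eq_sum_frame he hcard]; simp only [ricci_eq_sum_frame he hcard]; rfl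
  rw [selfDualBlock_eq_zero_iff, hs]
  constructor
  · rintro ⟨hasd, hsc⟩ i j
    have hperm : ∀ r : Equiv.Perm (Fin 4), Equiv.Perm.sign r = 1 → ∀ c d,
        weylComp (riemannComp g e x) (r 0) (r 1) c d
          + weylComp (riemannComp g e x) (r 2) (r 3) c d = 0 := by
      intro r hr c d
      rw [← weyl_frame he hE, ← weyl_frame he hE]
      refine hasd (fun a => e (r a) x) ⟨fun a b => ?_, ?_⟩ _ _
      · simp [he]
      · have : (Matrix.of fun i j => θ i (e (r j) x)) =
            (Matrix.of fun i j => θ i (e j x)).submatrix id r := rfl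
        rw [this, Matrix.det_permute', hr]
        simpa using hθ
    have hpart := selfDualPart_eq_zero_of_perm hperm
    have := hS.selfDualComp_weylComp i j
    rw [hsc, selfDualComp, hpart, hpart] at this
    simpa using this.symm
  · intro hA
    have hsc : scalarComp (riemannComp g e x) = 0 := by
      rw [hS.scalarComp_eq]; simp [hA]
    refine ⟨isAntiSelfDualAt_of_selfDualPart he hE hθ hS fun i c d => ?_, hsc⟩
    have h0 : ∀ j, selfDualComp (weylComp (riemannComp g e x)) i j = 0 := by
      intro j
      rw [hS.selfDualComp_weylComp, hA, hsc]; simp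
    have h1 := hS.selfDualPart_weylComp i
    refine forall_eq_zero_of_selfDualPart_pairs
      (T := selfDualPart (weylComp (riemannComp g e x)) i) (fun c d => ?_) (fun j => ?_)
      (fun j => ?_) c d
    · simp only [selfDualPart]
      rw [weylComp_antisymm_right hS _ _ c d, weylComp_antisymm_right hS _ 3 c d]; ring
    · have := h0 j; rw [selfDualComp] at this; linarith [h1 j]
    · have := h0 j; rw [selfDualComp] at this; linarith [h1 j]

end AntiSelfDual

section SelfDualConnection

theorem connectionCoeff_antisymm {X ι : Type*} {C : ι → ι → ι → X → ℝ}
    (hCa : ∀ a b c y, C a b c y = -C b a c y) (a b c : ι) (y : X) :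
    connectionCoeff C a b c y = -connectionCoeff C a c b y := by
  simp only [connectionCoeff]
  rw [hCa c b a]; ring

variable {E : Type*} [NormedAddCommGroup E] [NormedSpace ℝ E]
  {g : E → E →L[ℝ] E →L[ℝ] ℝ} {x : E} {e : Fin 4 → E → E} {C : Fin 4 → Fin 4 → Fin 4 → E → ℝ}

/-- The components of the Levi-Civita connection on self-dual bivectors. -/
def selfDualConnection (C : Fin 4 → Fin 4 → Fin 4 → E → ℝ) (j : Fin 3) (a : Fin 4) (y : E) : ℝ :=
  connectionCoeff C a (j + 2).castSucc (j + 1).castSucc y + connectionCoeff C a 3 j.castSucc y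

/-- The components of the curvature of the connection on self-dual bivectors. -/
def selfDualCurvature (C : Fin 4 → Fin 4 → Fin 4 → E → ℝ) (e : Fin 4 → E → E) (j : Fin 3)
    (p q : Fin 4) (x : E) : ℝ :=
  fderiv ℝ (selfDualConnection C j q) x (e p x) - fderiv ℝ (selfDualConnection C j p) x (e q x)
    + selfDualConnection C (j + 1) q x * selfDualConnection C (j + 2) p x
    - selfDualConnection C (j + 1) p x * selfDualConnection C (j + 2) q x
    - ∑ m, C p q m x * selfDualConnection C j m x

/-- The data of an orthonormal frame `e` on an open set `U` with structure functions `C`. -/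
structure IsFrameOn (g : E → E →L[ℝ] E →L[ℝ] ℝ) (e : Fin 4 → E → E)
    (C : Fin 4 → Fin 4 → Fin 4 → E → ℝ) (U : Set E) : Prop where
  isOpen : IsOpen U
  symm : ∀ y u v, g y u v = g y v u
  contDiffOn_metric : ContDiffOn ℝ 2 g U
  orthonormal : ∀ y ∈ U, ∀ a b, g y (e a y) (e b y) = if a = b then 1 else 0
  finrank : Module.finrank ℝ E = 4
  contDiffOn : ∀ a, ContDiffOn ℝ 2 (e a) U
  bracket : ∀ y ∈ U, ∀ a b,
    fderiv ℝ (e b) y (e a y) - fderiv ℝ (e a) y (e b y) = ∑ c, C a b c y • e c y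
  differentiableAt : ∀ y ∈ U, ∀ a b c, DifferentiableAt ℝ (C a b c) y
  antisymm : ∀ a b c y, C a b c y = -C b a c y

variable {U : Set E}

theorem IsFrameOn.differentiableAt_connectionCoeff (h : IsFrameOn g e C U) (hx : x ∈ U)
    (a b c : Fin 4) : DifferentiableAt ℝ (connectionCoeff C a b c) x := by
  have h1 := h.differentiableAt x hx a b c
  have h2 := h.differentiableAt x hx a c b
  have h3 := h.differentiableAt x hx b c a
  unfold connectionCoeff
  fun_prop

theorem IsFrameOn.riemannComp_eq [FiniteDimensional ℝ E] (h : IsFrameOn g e C U) (hx : x ∈ U)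
    (a b c d : Fin 4) :
    riemannComp g e x a b d c =
      fderiv ℝ (connectionCoeff C b c d) x (e a x) - fderiv ℝ (connectionCoeff C a c d) x (e b x)
      + ∑ m, (connectionCoeff C b c m x * connectionCoeff C a m d x
        - connectionCoeff C a c m x * connectionCoeff C b m d x
        - C a b m x * connectionCoeff C m c d x) :=
  riemann_frame h.isOpen hx h.symm h.contDiffOn_metric h.orthonormal (by simp [h.finrank])
    h.contDiffOn h.bracket (h.differentiableAt x hx) a b c d

theorem IsFrameOn.isAlgebraicCurvature [FiniteDimensional ℝ E] (h : IsFrameOn g e C U)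
    (hx : x ∈ U) : IsAlgebraicCurvature (riemannComp g e x) where
  antisymm_left a b c d := by
    simp only [riemannComp, riemann]
    rw [curvature_antisymm, map_neg, neg_apply]
  antisymm_right a b c d := by
    rw [h.riemannComp_eq hx, h.riemannComp_eq hx]
    have hG := connectionCoeff_antisymm h.antisymm
    have hfd : ∀ a b c, fderiv ℝ (connectionCoeff C a b c) x =
        -fderiv ℝ (connectionCoeff C a c b) x := by
      intro a b c
      rw [show connectionCoeff C a b c = fun y => -connectionCoeff C a c b y from
        funext fun y => hG a b c y, fderiv_fun_neg]
    rw [hfd b d c, hfd a d c]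
    simp only [Fin.sum_univ_four, neg_apply]
    simp only [hG _ d, hG _ _ c]
    ring
  bianchi a b c d := by
    simp only [riemannComp, riemann]
    rw [← add_apply, ← add_apply, ← map_add, ← map_add, curvature_bianchi h.symm]
    simp

theorem IsFrameOn.selfDualComp_riemannComp [FiniteDimensional ℝ E] (h : IsFrameOn g e C U)
    (hx : x ∈ U) (i j : Fin 3) :
    selfDualComp (riemannComp g e x) i j =
      selfDualCurvature C e j (i + 1).castSucc (i + 2).castSucc x
        + selfDualCurvature C e j i.castSucc 3 x := by
  have hd := h.differentiableAt_connectionCoeff hx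
  have hfd : ∀ j a, fderiv ℝ (selfDualConnection C j a) x =
      fderiv ℝ (connectionCoeff C a (j + 2).castSucc (j + 1).castSucc) x
        + fderiv ℝ (connectionCoeff C a 3 j.castSucc) x := by
    intro j a
    exact fderiv_fun_add (hd ..) (hd ..)
  have hG := connectionCoeff_antisymm h.antisymm
  have hz : ∀ a b, connectionCoeff C a b b x = 0 := fun a b => by linarith [hG a b b x]
  have key : ∀ j p q, riemannComp g e x p q (j + 1).castSucc (j + 2).castSucc
      + riemannComp g e x p q j.castSucc 3 = selfDualCurvature C e j p q x := by
    intro j p q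
    rw [h.riemannComp_eq hx, h.riemannComp_eq hx, selfDualCurvature, hfd, hfd]
    simp only [add_apply, selfDualConnection, Fin.sum_univ_four]
    have d1 : Fin.castSucc (0 : Fin 3) = (0 : Fin 4) := rfl
    have d2 : Fin.castSucc (1 : Fin 3) = (1 : Fin 4) := rfl
    have d3 : Fin.castSucc (2 : Fin 3) = (2 : Fin 4) := rfl
    have s1 : (1 + 1 : Fin 3) = 2 := rfl
    have s2 : (1 + 2 : Fin 3) = 0 := rfl
    have s3 : (2 + 1 : Fin 3) = 0 := rfl
    have s4 : (2 + 2 : Fin 3) = 1 := rfl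
    fin_cases j <;>
      simp only [Fin.zero_eta, Fin.mk_one, Fin.reduceFinMk, zero_add, s1, s2, s3, s4, d1, d2, d3,
        hz, hG _ 1 0, hG _ 2 0, hG _ 3 0, hG _ 2 1, hG _ 3 1, hG _ 3 2] <;> ring
  rw [selfDualComp, ← key j, ← key j, selfDualPart, selfDualPart]
  ring

end SelfDualConnection

end MetricTensor

namespace SU2Metric

section Coordinates

theorem unit_re (i : Fin 3) : (unit i).re = 0 := by fin_cases i <;> rfl

theorem unit_imI (i : Fin 3) : (unit i).imI = if i = 0 then 1 else 0 := by
  fin_cases i <;> simp [unit]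

theorem unit_imJ (i : Fin 3) : (unit i).imJ = if i = 1 then 1 else 0 := by
  fin_cases i <;> simp [unit]

theorem unit_imK (i : Fin 3) : (unit i).imK = if i = 2 then 1 else 0 := by
  fin_cases i <;> simp [unit]

theorem contDiffAt_time {q : ℍ[ℝ]} (hq : q ≠ 0) {n : WithTop ℕ∞} : ContDiffAt ℝ n time q :=
  (contDiffAt_norm ℝ hq).log (norm_ne_zero_iff.mpr hq)

theorem differentiableAt_time {q : ℍ[ℝ]} (hq : q ≠ 0) : DifferentiableAt ℝ time q :=
  (contDiffAt_time hq (n := 1)).differentiableAt (by norm_num)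

theorem isOpen_region {J : Set ℝ} (hJ : IsOpen J) : IsOpen (region J) := by
  have h : ContinuousOn time {q : ℍ[ℝ] | q ≠ 0} := fun q hq =>
    (differentiableAt_time hq).continuousAt.continuousWithinAt
  exact h.isOpen_inter_preimage isOpen_ne hJ

theorem exists_mem_region {J : Set ℝ} {t : ℝ} (ht : t ∈ J) : ∃ q ∈ region J, time q = t := by
  have h : time ((Real.exp t : ℝ) : ℍ[ℝ]) = t := by
    simp [time, Quaternion.norm_coe, Real.log_exp]
  refine ⟨((Real.exp t : ℝ) : ℍ[ℝ]), ⟨fun h0 => ?_, by rwa [h]⟩, h⟩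
  have := congrArg (fun q : ℍ[ℝ] => ‖q‖) h0
  simp [Quaternion.norm_coe] at this

theorem dt_apply {q : ℍ[ℝ]} (hq : q ≠ 0) (v : ℍ[ℝ]) : dt q v = inner ℝ q v / ‖q‖ ^ 2 := by
  have h1 : time = fun q : ℍ[ℝ] => (1 / 2) * Real.log (‖q‖ ^ 2) := by
    funext q
    simp [time, Real.log_pow]
  have h2 : HasFDerivAt (fun q : ℍ[ℝ] => ‖q‖ ^ 2) (2 • innerSL ℝ q) q :=
    (hasStrictFDerivAt_norm_sq q).hasFDerivAt
  have h3 := (h2.log (pow_ne_zero 2 (norm_ne_zero_iff.mpr hq))).const_mul (1 / 2)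
  rw [dt, h1, h3.fderiv]
  simp
  ring

/-- The invariant frame `(dualField 0, dualField 1, dualField 2, ∂/∂t)` as linear vector fields. -/
def invariantField (i : Fin 4) : ℍ[ℝ] →L[ℝ] ℍ[ℝ] :=
  ![(-(1 / 2) : ℝ) • (ContinuousLinearMap.mul ℝ ℍ[ℝ]).flip (unit 0),
    (-(1 / 2) : ℝ) • (ContinuousLinearMap.mul ℝ ℍ[ℝ]).flip (unit 1),
    (-(1 / 2) : ℝ) • (ContinuousLinearMap.mul ℝ ℍ[ℝ]).flip (unit 2),
    ContinuousLinearMap.id ℝ ℍ[ℝ]] i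

theorem invariantField_castSucc (i : Fin 3) (q : ℍ[ℝ]) :
    invariantField i.castSucc q = dualField i q := by
  fin_cases i <;> rfl

theorem invariantField_three (q : ℍ[ℝ]) : invariantField 3 q = q := rfl

theorem dt_dualField {q : ℍ[ℝ]} (hq : q ≠ 0) (i : Fin 3) : dt q (dualField i q) = 0 := by
  rw [dt_apply hq]
  refine div_eq_zero_iff.mpr (Or.inl ?_)
  simp [dualField, unit_re, Quaternion.inner_def]
  ring

theorem dt_self {q : ℍ[ℝ]} (hq : q ≠ 0) : dt q q = 1 := by
  rw [dt_apply hq, real_inner_self_eq_norm_sq]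
  exact div_self (pow_ne_zero 2 (norm_ne_zero_iff.mpr hq))

theorem dt_invariantField {q : ℍ[ℝ]} (hq : q ≠ 0) (i : Fin 4) :
    dt q (invariantField i q) = if i = 3 then 1 else 0 := by
  refine Fin.lastCases ?_ (fun i => ?_) i
  · exact dt_self hq
  · rw [invariantField_castSucc, dt_dualField hq]
    exact (if_neg (Fin.castSucc_lt_last i).ne).symm

theorem sigma_dualField {q : ℍ[ℝ]} (hq : q ≠ 0) (i j : Fin 3) :
    sigma i q (dualField j q) = if i = j then 1 else 0 := by
  have h : q⁻¹ * (q * unit j) = unit j := by rw [← mul_assoc, inv_mul_cancel₀ hq, one_mul]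
  simp only [sigma, dualField, smul_apply, ContinuousLinearMap.comp_apply, map_smul,
    ContinuousLinearMap.mul_apply', h]
  rw [innerSL_apply_apply, Quaternion.inner_def]
  fin_cases i <;> fin_cases j <;> simp [unit_re, unit_imI, unit_imJ, unit_imK]

theorem sigma_self {q : ℍ[ℝ]} (hq : q ≠ 0) (i : Fin 3) : sigma i q q = 0 := by
  simp only [sigma, smul_apply, ContinuousLinearMap.comp_apply,
    ContinuousLinearMap.mul_apply', inv_mul_cancel₀ hq]
  simp [unit_re, Quaternion.inner_def]

/-- The structure constants of the invariant frame. -/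
def invariantConst (i j k : Fin 4) : ℝ :=
  (![![![0, 0, 0, 0], ![0, 0, -1, 0], ![0, 1, 0, 0], ![0, 0, 0, 0]],
    ![![0, 0, 1, 0], ![0, 0, 0, 0], ![-1, 0, 0, 0], ![0, 0, 0, 0]],
    ![![0, -1, 0, 0], ![1, 0, 0, 0], ![0, 0, 0, 0], ![0, 0, 0, 0]],
    ![![0, 0, 0, 0], ![0, 0, 0, 0], ![0, 0, 0, 0], ![0, 0, 0, 0]]] :
    Fin 4 → Fin 4 → Fin 4 → ℝ) i j k

theorem unit_mul_sub_unit_mul (i j : Fin 3) :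
    unit i * unit j - unit j * unit i =
      (-2 : ℝ) • ∑ k, invariantConst i.castSucc j.castSucc (Fin.castSucc k) • unit k := by
  rw [Fin.sum_univ_three]
  ext <;> fin_cases i <;> fin_cases j <;>
    simp [unit_re, unit_imI, unit_imJ, unit_imK, invariantConst] <;> norm_num

theorem invariantField_bracket (i j : Fin 4) (q : ℍ[ℝ]) :
    invariantField j (invariantField i q) - invariantField i (invariantField j q) =
      ∑ k, invariantConst i j k • invariantField k q := by
  refine Fin.lastCases ?_ (fun i => ?_) i
  · have h : ∀ k, invariantConst 3 j k = 0 := by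
      intro k
      fin_cases j <;> fin_cases k <;> rfl
    change invariantField j q - invariantField j q = ∑ k, invariantConst 3 j k • _
    simp [h]
  · refine Fin.lastCases ?_ (fun j => ?_) j
    · have h : ∀ k, invariantConst i.castSucc 3 k = 0 := by
        intro k
        fin_cases i <;> fin_cases k <;> rfl
      change invariantField _ q - invariantField _ q = ∑ k, invariantConst _ 3 k • _
      simp [h]
    · have h : invariantConst i.castSucc j.castSucc (Fin.last 3) = 0 := by
        fin_cases i <;> fin_cases j <;> rfl
      rw [Fin.sum_univ_castSucc, h, zero_smul, add_zero]
      simp only [invariantField_castSucc, dualField, smul_mul_assoc, mul_assoc, smul_smul]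
      rw [← smul_sub, ← mul_sub, unit_mul_sub_unit_mul]
      simp only [Finset.smul_sum, Finset.mul_sum, mul_smul_comm, smul_smul]
      refine Finset.sum_congr rfl fun k _ => ?_
      congr 1
      ring

end Coordinates

section InvariantFrame

variable {r r' : Fin 4 → Fin 4 → ℝ → ℝ} {q : ℍ[ℝ]}

theorem hasFDerivAt_comp_time {f : ℝ → ℝ} {f' : ℝ} (hq : q ≠ 0) (hf : HasDerivAt f f' (time q)) :
    HasFDerivAt (fun y => f (time y)) (f' • dt q) q :=
  hf.comp_hasFDerivAt q (differentiableAt_time hq).hasFDerivAt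

theorem fderiv_sum_invariantField (hq : q ≠ 0) (r r' : Fin 4 → ℝ → ℝ)
    (hr : ∀ j, HasDerivAt (r j) (r' j (time q)) (time q)) (v : ℍ[ℝ]) :
    fderiv ℝ (fun y => ∑ j, r j (time y) • invariantField j y) q v =
      ∑ j, (r j (time q) • invariantField j v + (r' j (time q) * dt q v) • invariantField j q) := by
  have h : HasFDerivAt (fun y => ∑ j, r j (time y) • invariantField j y)
      (∑ j, (r j (time q) • invariantField j
        + (r' j (time q) • dt q).smulRight (invariantField j q))) q :=
    HasFDerivAt.fun_sum fun j _ =>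
      (hasFDerivAt_comp_time hq (hr j)).fun_smul (invariantField j).hasFDerivAt
  rw [h.fderiv]
  simp

/-- The bracket of vector fields with coefficients depending only on `t` in the invariant frame. -/
theorem bracket_sum_invariantField (hq : q ≠ 0)
    (hr : ∀ a j, HasDerivAt (r a j) (r' a j (time q)) (time q)) (a b : Fin 4) :
    fderiv ℝ (fun y => ∑ j, r b j (time y) • invariantField j y) q
        (∑ j, r a j (time q) • invariantField j q)
      - fderiv ℝ (fun y => ∑ j, r a j (time y) • invariantField j y) q
        (∑ j, r b j (time q) • invariantField j q) =
      ∑ k, (r a 3 (time q) * r' b k (time q) - r b 3 (time q) * r' a k (time q)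
        + ∑ i, ∑ j, r a i (time q) * r b j (time q) * invariantConst i j k) •
          invariantField k q := by
  rw [fderiv_sum_invariantField hq _ _ (hr b), fderiv_sum_invariantField hq _ _ (hr a)]
  have hdt : ∀ a, dt q (∑ j, r a j (time q) • invariantField j q) = r a 3 (time q) := by
    intro a; simp [dt_invariantField hq]
  have hsum : ∑ i, ∑ j, (r a i (time q) * r b j (time q)) •
      ∑ k, invariantConst i j k • invariantField k q =
      ∑ k, (∑ i, ∑ j, r a i (time q) * r b j (time q) * invariantConst i j k) •
        invariantField k q := by
    simp only [Finset.smul_sum, Finset.sum_smul, smul_smul]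
    rw [Finset.sum_comm_cycle]
  simp only [add_smul _ (∑ i, _), Finset.sum_add_distrib, ← hsum, ← invariantField_bracket, hdt,
    map_sum, map_smul, smul_sub, Finset.sum_sub_distrib, sub_smul, Finset.smul_sum, smul_smul]
  rw [Finset.sum_comm (f := fun i j => (r a i (time q) * r b j (time q)) •
    invariantField j (invariantField i q))]
  simp only [mul_comm (r b _ (time q)) (r a _ (time q)), mul_comm (r' _ _ (time q))]
  abel

end InvariantFrame

/-- Functions `a, b, c, R, ξ, α` of `t ∈ J` such that `Ṙ R⁻¹` is the rotation matrix of `ξ` and the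
logarithmic derivatives of `a, b, c` are expressed by `α`. -/
structure IsRotatingFamily (J : Set ℝ) (a b c : ℝ → ℝ) (R : ℝ → Matrix (Fin 3) (Fin 3) ℝ)
    (ξ₁ ξ₂ ξ₃ α₁ α₂ α₃ : ℝ → ℝ) : Prop where
  isOpen : IsOpen J
  contDiffOn_a : ContDiffOn ℝ ∞ a J
  contDiffOn_b : ContDiffOn ℝ ∞ b J
  contDiffOn_c : ContDiffOn ℝ ∞ c J
  contDiffOn_R : ∀ i j, ContDiffOn ℝ ∞ (fun t => R t i j) J
  a_ne_zero : ∀ t ∈ J, a t ≠ 0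
  b_ne_zero : ∀ t ∈ J, b t ≠ 0
  c_ne_zero : ∀ t ∈ J, c t ≠ 0
  specialOrthogonal : ∀ t ∈ J, R t ∈ Matrix.specialOrthogonalGroup (Fin 3) ℝ
  hasDerivAt_a : ∀ t ∈ J, HasDerivAt a (a t * (α₁ t - (b t ^ 2 + c t ^ 2 - a t ^ 2) / 2)) t
  hasDerivAt_b : ∀ t ∈ J, HasDerivAt b (b t * (α₂ t - (c t ^ 2 + a t ^ 2 - b t ^ 2) / 2)) t
  hasDerivAt_c : ∀ t ∈ J, HasDerivAt c (c t * (α₃ t - (a t ^ 2 + b t ^ 2 - c t ^ 2) / 2)) t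
  hasDerivAt_R : ∀ t ∈ J, ∀ i j, HasDerivAt (fun s => R s i j)
    ((rotationMatrix (ξ₁ t) (ξ₂ t) (ξ₃ t) * R t) i j) t
  differentiableAt_ξ₁ : ∀ t ∈ J, DifferentiableAt ℝ ξ₁ t
  differentiableAt_ξ₂ : ∀ t ∈ J, DifferentiableAt ℝ ξ₂ t
  differentiableAt_ξ₃ : ∀ t ∈ J, DifferentiableAt ℝ ξ₃ t
  differentiableAt_α₁ : ∀ t ∈ J, DifferentiableAt ℝ α₁ t
  differentiableAt_α₂ : ∀ t ∈ J, DifferentiableAt ℝ α₂ t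
  differentiableAt_α₃ : ∀ t ∈ J, DifferentiableAt ℝ α₃ t

/-- The coefficients of the orthonormal frame in the invariant frame. -/
def frameCoeff (a b c : ℝ → ℝ) (R : ℝ → Matrix (Fin 3) (Fin 3) ℝ) : Fin 4 → Fin 4 → ℝ → ℝ :=
  ![![fun t => (a t)⁻¹ * R t 0 0, fun t => (a t)⁻¹ * R t 0 1, fun t => (a t)⁻¹ * R t 0 2, 0],
    ![fun t => (b t)⁻¹ * R t 1 0, fun t => (b t)⁻¹ * R t 1 1, fun t => (b t)⁻¹ * R t 1 2, 0],
    ![fun t => (c t)⁻¹ * R t 2 0, fun t => (c t)⁻¹ * R t 2 1, fun t => (c t)⁻¹ * R t 2 2, 0],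
    ![0, 0, 0, fun t => (a t * b t * c t)⁻¹]]

/-- The orthonormal frame dual to `a σ̃₁, b σ̃₂, c σ̃₃, abc dt`. -/
def frame (a b c : ℝ → ℝ) (R : ℝ → Matrix (Fin 3) (Fin 3) ℝ) (i : Fin 4) (q : ℍ[ℝ]) : ℍ[ℝ] :=
  ∑ j, frameCoeff a b c R i j (time q) • invariantField j q

theorem frame_castSucc (a b c : ℝ → ℝ) (R : ℝ → Matrix (Fin 3) (Fin 3) ℝ) (i : Fin 3) (q : ℍ[ℝ]) :
    frame a b c R i.castSucc q = orbitFrame a b c R q i := by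
  have h0 := invariantField_castSucc 0 q
  have h1 := invariantField_castSucc 1 q
  have h2 := invariantField_castSucc 2 q
  simp only [Fin.castSucc_zero, Fin.castSucc_one, Fin.reduceCastSucc] at h0 h1 h2
  rw [frame, orbitFrame, Fin.sum_univ_four, Fin.sum_univ_three]
  fin_cases i <;> simp [frameCoeff, h0, h1, h2, smul_smul]

theorem frame_three (a b c : ℝ → ℝ) (R : ℝ → Matrix (Fin 3) (Fin 3) ℝ) (q : ℍ[ℝ]) :
    frame a b c R 3 q = normal a b c q := by
  rw [frame, normal, Fin.sum_univ_four]
  simp [frameCoeff, invariantField_three]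

theorem blockA_eq (a b c : ℝ → ℝ) (R : ℝ → Matrix (Fin 3) (Fin 3) ℝ) (q : ℍ[ℝ]) :
    blockA a b c R q = MetricTensor.selfDualBlock (metric a b c R) q
      (fun i => frame a b c R i.castSucc q) (frame a b c R 3 q) := by
  rw [blockA, frame_three]
  congr 1
  funext i
  exact (frame_castSucc a b c R i q).symm

/-- The structure functions of the orthonormal frame, where `xᵢ = ξᵢ / (wⱼ wₖ)`. -/
def structureFunction (a b c x₁ x₂ x₃ α₁ α₂ α₃ : ℝ → ℝ) (i j k : Fin 4) (t : ℝ) : ℝ :=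
  (![![![0, 0, 0, 0],
      ![0, 0, -c t ^ 2, 0],
      ![0, b t ^ 2, 0, 0],
      ![α₁ t - (b t ^ 2 + c t ^ 2 - a t ^ 2) / 2, -(x₃ t * (b t * c t) ^ 2),
        x₂ t * (b t * c t) ^ 2, 0]],
    ![![0, 0, c t ^ 2, 0],
      ![0, 0, 0, 0],
      ![-a t ^ 2, 0, 0, 0],
      ![x₃ t * (c t * a t) ^ 2, α₂ t - (c t ^ 2 + a t ^ 2 - b t ^ 2) / 2,
        -(x₁ t * (c t * a t) ^ 2), 0]],
    ![![0, -b t ^ 2, 0, 0],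
      ![a t ^ 2, 0, 0, 0],
      ![0, 0, 0, 0],
      ![-(x₂ t * (a t * b t) ^ 2), x₁ t * (a t * b t) ^ 2,
        α₃ t - (a t ^ 2 + b t ^ 2 - c t ^ 2) / 2, 0]],
    ![![-(α₁ t - (b t ^ 2 + c t ^ 2 - a t ^ 2) / 2), x₃ t * (b t * c t) ^ 2,
        -(x₂ t * (b t * c t) ^ 2), 0],
      ![-(x₃ t * (c t * a t) ^ 2), -(α₂ t - (c t ^ 2 + a t ^ 2 - b t ^ 2) / 2),
        x₁ t * (c t * a t) ^ 2, 0],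
      ![x₂ t * (a t * b t) ^ 2, -(x₁ t * (a t * b t) ^ 2),
        -(α₃ t - (a t ^ 2 + b t ^ 2 - c t ^ 2) / 2), 0],
      ![0, 0, 0, 0]]] : Fin 4 → Fin 4 → Fin 4 → ℝ) i j k / (a t * b t * c t)

theorem structureFunction_antisymm (a b c x₁ x₂ x₃ α₁ α₂ α₃ : ℝ → ℝ) (i j k : Fin 4) (t : ℝ) :
    structureFunction a b c x₁ x₂ x₃ α₁ α₂ α₃ i j k t =
      -structureFunction a b c x₁ x₂ x₃ α₁ α₂ α₃ j i k t := by
  rw [structureFunction, structureFunction, ← neg_div]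
  congr 1
  fin_cases i <;> fin_cases j <;> fin_cases k <;> simp

theorem adjugate_of_mem_specialOrthogonalGroup {M : Matrix (Fin 3) (Fin 3) ℝ}
    (hM : M ∈ Matrix.specialOrthogonalGroup (Fin 3) ℝ) : M.adjugate = M.transpose := by
  rw [Matrix.mem_specialOrthogonalGroup_iff, Matrix.mem_orthogonalGroup_iff'] at hM
  have h1 : M.transpose * M = 1 := by simpa [Matrix.star_eq_conjTranspose] using hM.1
  calc M.adjugate = (M.transpose * M) * M.adjugate := by rw [h1, one_mul]
    _ = M.transpose := by rw [mul_assoc, Matrix.mul_adjugate, hM.2, one_smul, mul_one]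

theorem row_orthonormal {M : Matrix (Fin 3) (Fin 3) ℝ}
    (hM : M ∈ Matrix.specialOrthogonalGroup (Fin 3) ℝ) (i k : Fin 3) :
    ∑ j, M i j * M k j = if i = k then 1 else 0 := by
  rw [Matrix.mem_specialOrthogonalGroup_iff, Matrix.mem_orthogonalGroup_iff] at hM
  have h1 := congrFun (congrFun hM.1 i) k
  simpa [Matrix.mul_apply, Matrix.one_apply, Matrix.star_eq_conjTranspose] using h1

theorem sigma_frame {a b c : ℝ → ℝ} {R : ℝ → Matrix (Fin 3) (Fin 3) ℝ} {q : ℍ[ℝ]} (hq : q ≠ 0)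
    (i : Fin 3) (k : Fin 4) :
    sigma i q (frame a b c R k q) = frameCoeff a b c R k i.castSucc (time q) := by
  rw [frame, Fin.sum_univ_castSucc, map_add, map_sum]
  simp only [map_smul, invariantField_castSucc, sigma_dualField hq]
  rw [show invariantField (Fin.last 3) q = q from rfl, sigma_self hq]
  simp

theorem dt_frame {a b c : ℝ → ℝ} {R : ℝ → Matrix (Fin 3) (Fin 3) ℝ} {q : ℍ[ℝ]} (hq : q ≠ 0)
    (k : Fin 4) : dt q (frame a b c R k q) = frameCoeff a b c R k 3 (time q) := by
  simp [frame, dt_invariantField hq]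

theorem metric_symm (a b c : ℝ → ℝ) (R : ℝ → Matrix (Fin 3) (Fin 3) ℝ) (q u v : ℍ[ℝ]) :
    metric a b c R q u v = metric a b c R q v u := by
  simp [metric, mul_comm]

theorem contDiffAt_sigma {q : ℍ[ℝ]} (hq : q ≠ 0) (i : Fin 3) : ContDiffAt ℝ 2 (sigma i) q := by
  have h1 : ContDiffAt ℝ 2 (fun y : ℍ[ℝ] => y⁻¹) q := by
    have := contDiffAt_ringInverse ℝ (n := 2) (Units.mk0 q hq)
    simpa [Ring.inverse_eq_inv'] using this
  have h2 : ContDiffAt ℝ 2 (fun y : ℍ[ℝ] => ContinuousLinearMap.mul ℝ ℍ[ℝ] y⁻¹) q :=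
    (ContinuousLinearMap.mul ℝ ℍ[ℝ]).contDiff.contDiffAt.comp q h1
  unfold sigma
  exact (contDiffAt_const.clm_comp h2).const_smul _

theorem contDiffAt_dt {q : ℍ[ℝ]} (hq : q ≠ 0) : ContDiffAt ℝ 2 dt q :=
  (contDiffAt_time hq (n := 3)).fderiv_right (by norm_num)

variable {J : Set ℝ} {a b c : ℝ → ℝ} {R : ℝ → Matrix (Fin 3) (Fin 3) ℝ}
  {ξ₁ ξ₂ ξ₃ α₁ α₂ α₃ : ℝ → ℝ}

theorem contDiffAt_comp_time {f : ℝ → ℝ} {q : ℍ[ℝ]} (hf : ContDiffOn ℝ ∞ f J) (hJ : IsOpen J)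
    (hq : q ∈ region J) : ContDiffAt ℝ 2 (fun y => f (time y)) q :=
  ((hf.contDiffAt (hJ.mem_nhds hq.2)).of_le (WithTop.coe_le_coe.2 (le_top : (2 : ℕ∞) ≤ ⊤))).comp q
    (contDiffAt_time hq.1)

namespace IsRotatingFamily

set_option maxSynthPendingDepth 5 in
theorem contDiffOn_metric (h : IsRotatingFamily J a b c R ξ₁ ξ₂ ξ₃ α₁ α₂ α₃) :
    ContDiffOn ℝ 2 (metric a b c R) (region J) := by
  intro q hq
  apply ContDiffAt.contDiffWithinAt
  have ha := contDiffAt_comp_time h.contDiffOn_a h.isOpen hq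
  have hb := contDiffAt_comp_time h.contDiffOn_b h.isOpen hq
  have hc := contDiffAt_comp_time h.contDiffOn_c h.isOpen hq
  have hdt := contDiffAt_dt hq.1
  have hs : ∀ i, ContDiffAt ℝ 2 (rotSigma R i) q := fun i =>
    ContDiffAt.sum fun j _ =>
      (contDiffAt_comp_time (h.contDiffOn_R i j) h.isOpen hq).smul (contDiffAt_sigma hq.1 j)
  unfold metric
  exact (((((ha.mul hb).mul hc).pow 2).smul (hdt.smulRight hdt)).add
    ((ha.pow 2).smul ((hs 0).smulRight (hs 0)))).add
    ((hb.pow 2).smul ((hs 1).smulRight (hs 1))) |>.add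
    ((hc.pow 2).smul ((hs 2).smulRight (hs 2)))

theorem contDiffOn_frame (h : IsRotatingFamily J a b c R ξ₁ ξ₂ ξ₃ α₁ α₂ α₃) (i : Fin 4) :
    ContDiffOn ℝ 2 (frame a b c R i) (region J) := by
  intro q hq
  apply ContDiffAt.contDiffWithinAt
  have ha := contDiffAt_comp_time h.contDiffOn_a h.isOpen hq
  have hb := contDiffAt_comp_time h.contDiffOn_b h.isOpen hq
  have hc := contDiffAt_comp_time h.contDiffOn_c h.isOpen hq
  have ha0 := h.a_ne_zero _ hq.2
  have hb0 := h.b_ne_zero _ hq.2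
  have hc0 := h.c_ne_zero _ hq.2
  have hR := fun i j => contDiffAt_comp_time (h.contDiffOn_R i j) h.isOpen hq
  have hr : ∀ j, ContDiffAt ℝ 2 (fun y => frameCoeff a b c R i j (time y)) q := by
    intro j
    fin_cases i <;> fin_cases j
    all_goals first
      | exact contDiffAt_const
      | exact (ha.inv ha0).mul (hR _ _)
      | exact (hb.inv hb0).mul (hR _ _)
      | exact (hc.inv hc0).mul (hR _ _)
      | exact ((ha.mul hb).mul hc).inv (mul_ne_zero (mul_ne_zero ha0 hb0) hc0)
  exact ContDiffAt.sum fun j _ => (hr j).smul (invariantField j).contDiff.contDiffAt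

theorem orthonormal (h : IsRotatingFamily J a b c R ξ₁ ξ₂ ξ₃ α₁ α₂ α₃)
    {q : ℍ[ℝ]} (hq : q ∈ region J) (i j : Fin 4) :
    metric a b c R q (frame a b c R i q) (frame a b c R j q) = if i = j then 1 else 0 := by
  have ha0 := h.a_ne_zero _ hq.2
  have hb0 := h.b_ne_zero _ hq.2
  have hc0 := h.c_ne_zero _ hq.2
  have ho := row_orthonormal (h.specialOrthogonal _ hq.2)
  simp only [Fin.sum_univ_three] at ho
  have hrot : ∀ i k, rotSigma R i q (frame a b c R k q) =
      (![![(a (time q))⁻¹, 0, 0, 0], ![0, (b (time q))⁻¹, 0, 0], ![0, 0, (c (time q))⁻¹, 0]] :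
        Fin 3 → Fin 4 → ℝ) i k := by
    intro i k
    simp only [rotSigma, Fin.sum_univ_three, add_apply, smul_apply, sigma_frame hq.1, smul_eq_mul]
    fin_cases k
    · have := ho i 0
      fin_cases i <;> simp [frameCoeff] at this ⊢ <;> linear_combination (a (time q))⁻¹ * this
    · have := ho i 1
      fin_cases i <;> simp [frameCoeff] at this ⊢ <;> linear_combination (b (time q))⁻¹ * this
    · have := ho i 2
      fin_cases i <;> simp [frameCoeff] at this ⊢ <;> linear_combination (c (time q))⁻¹ * this
    · fin_cases i <;> simp [frameCoeff]
  simp only [metric, add_apply, smul_apply, ContinuousLinearMap.smulRight_apply, hrot,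
    dt_frame hq.1, smul_eq_mul]
  fin_cases i <;> fin_cases j <;> simp [frameCoeff] <;> field_simp

theorem coframe_det_pos (h : IsRotatingFamily J a b c R ξ₁ ξ₂ ξ₃ α₁ α₂ α₃)
    {q : ℍ[ℝ]} (hq : q ∈ region J) :
    0 < (Matrix.of fun i j => coframe q i (frame a b c R j q)).det := by
  have ha0 := h.a_ne_zero _ hq.2
  have hb0 := h.b_ne_zero _ hq.2
  have hc0 := h.c_ne_zero _ hq.2
  have hd : (R (time q)).det = 1 :=
    (Matrix.mem_specialOrthogonalGroup_iff.mp (h.specialOrthogonal _ hq.2)).2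
  rw [Matrix.det_fin_three] at hd
  have hM : (Matrix.of fun i j => coframe q i (frame a b c R j q)) =
      Matrix.of fun i j => frameCoeff a b c R j i (time q) := by
    ext i j
    fin_cases i
    · exact sigma_frame hq.1 0 j
    · exact sigma_frame hq.1 1 j
    · exact sigma_frame hq.1 2 j
    · exact dt_frame hq.1 j
  have hdet : (Matrix.of fun i j => frameCoeff a b c R j i (time q)).det =
      ((a (time q) * b (time q) * c (time q))⁻¹) ^ 2 := by
    rw [Matrix.det_succ_row_zero]
    simp [Fin.sum_univ_succ, Fin.succAbove, Matrix.det_fin_three, frameCoeff]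
    linear_combination ((a (time q) * b (time q) * c (time q))⁻¹) ^ 2 * hd
  rw [hM, hdet]
  positivity

end IsRotatingFamily

/-- The quantity `ξ₁ / (w₂ w₃)`; the others arise by cyclic permutation. -/
def reducedXi (a b c ξ₁ : ℝ → ℝ) (t : ℝ) : ℝ := ξ₁ t / (c t * a t * (a t * b t))

/-- The structure functions of the orthonormal frame on `J × SU(2)`. -/
def frameStructure (a b c ξ₁ ξ₂ ξ₃ α₁ α₂ α₃ : ℝ → ℝ) (i j k : Fin 4) (q : ℍ[ℝ]) : ℝ :=
  structureFunction a b c (reducedXi a b c ξ₁) (reducedXi b c a ξ₂) (reducedXi c a b ξ₃)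
    α₁ α₂ α₃ i j k (time q)

namespace IsRotatingFamily

theorem hasDerivAt_volume (h : IsRotatingFamily J a b c R ξ₁ ξ₂ ξ₃ α₁ α₂ α₃) {t : ℝ} (ht : t ∈ J) :
    HasDerivAt (fun s => a s * b s * c s) (a t * b t * c t *
      (α₁ t + α₂ t + α₃ t - (a t ^ 2 + b t ^ 2 + c t ^ 2) / 2)) t := by
  refine (((h.hasDerivAt_a t ht).fun_mul (h.hasDerivAt_b t ht)).fun_mul
    (h.hasDerivAt_c t ht)).congr_deriv ?_
  ring

/-- The derivatives of the coefficients of the orthonormal frame. -/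
theorem hasDerivAt_frameCoeff (h : IsRotatingFamily J a b c R ξ₁ ξ₂ ξ₃ α₁ α₂ α₃) {t : ℝ}
    (ht : t ∈ J) (i j : Fin 4) :
    HasDerivAt (frameCoeff a b c R i j)
      ((![![(a t)⁻¹ * (ξ₃ t * R t 1 0 - ξ₂ t * R t 2 0
              - (α₁ t - (b t ^ 2 + c t ^ 2 - a t ^ 2) / 2) * R t 0 0),
            (a t)⁻¹ * (ξ₃ t * R t 1 1 - ξ₂ t * R t 2 1
              - (α₁ t - (b t ^ 2 + c t ^ 2 - a t ^ 2) / 2) * R t 0 1),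
            (a t)⁻¹ * (ξ₃ t * R t 1 2 - ξ₂ t * R t 2 2
              - (α₁ t - (b t ^ 2 + c t ^ 2 - a t ^ 2) / 2) * R t 0 2), 0],
          ![(b t)⁻¹ * (ξ₁ t * R t 2 0 - ξ₃ t * R t 0 0
              - (α₂ t - (c t ^ 2 + a t ^ 2 - b t ^ 2) / 2) * R t 1 0),
            (b t)⁻¹ * (ξ₁ t * R t 2 1 - ξ₃ t * R t 0 1
              - (α₂ t - (c t ^ 2 + a t ^ 2 - b t ^ 2) / 2) * R t 1 1),
            (b t)⁻¹ * (ξ₁ t * R t 2 2 - ξ₃ t * R t 0 2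
              - (α₂ t - (c t ^ 2 + a t ^ 2 - b t ^ 2) / 2) * R t 1 2), 0],
          ![(c t)⁻¹ * (ξ₂ t * R t 0 0 - ξ₁ t * R t 1 0
              - (α₃ t - (a t ^ 2 + b t ^ 2 - c t ^ 2) / 2) * R t 2 0),
            (c t)⁻¹ * (ξ₂ t * R t 0 1 - ξ₁ t * R t 1 1
              - (α₃ t - (a t ^ 2 + b t ^ 2 - c t ^ 2) / 2) * R t 2 1),
            (c t)⁻¹ * (ξ₂ t * R t 0 2 - ξ₁ t * R t 1 2
              - (α₃ t - (a t ^ 2 + b t ^ 2 - c t ^ 2) / 2) * R t 2 2), 0],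
          ![0, 0, 0, -(a t * b t * c t)⁻¹ *
              (α₁ t + α₂ t + α₃ t - (a t ^ 2 + b t ^ 2 + c t ^ 2) / 2)]] :
        Fin 4 → Fin 4 → ℝ) i j) t := by
  have ha0 := h.a_ne_zero t ht
  have hb0 := h.b_ne_zero t ht
  have hc0 := h.c_ne_zero t ht
  have hN0 : a t * b t * c t ≠ 0 := mul_ne_zero (mul_ne_zero ha0 hb0) hc0
  have hR := h.hasDerivAt_R t ht
  have h0 : ∀ j, (rotationMatrix (ξ₁ t) (ξ₂ t) (ξ₃ t) * R t) 0 j =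
      ξ₃ t * R t 1 j - ξ₂ t * R t 2 j := fun j => by
    simp [rotationMatrix, Matrix.mul_apply, Fin.sum_univ_three]; ring
  have h1 : ∀ j, (rotationMatrix (ξ₁ t) (ξ₂ t) (ξ₃ t) * R t) 1 j =
      ξ₁ t * R t 2 j - ξ₃ t * R t 0 j := fun j => by
    simp [rotationMatrix, Matrix.mul_apply, Fin.sum_univ_three]; ring
  have h2 : ∀ j, (rotationMatrix (ξ₁ t) (ξ₂ t) (ξ₃ t) * R t) 2 j =
      ξ₂ t * R t 0 j - ξ₁ t * R t 1 j := fun j => by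
    simp [rotationMatrix, Matrix.mul_apply, Fin.sum_univ_three]; ring
  have key : ∀ {f : ℝ → ℝ} {p m : ℝ} {i j : Fin 3}, f t ≠ 0 → HasDerivAt f (f t * p) t →
      (rotationMatrix (ξ₁ t) (ξ₂ t) (ξ₃ t) * R t) i j = m →
      HasDerivAt (fun s => (f s)⁻¹ * R s i j) ((f t)⁻¹ * (m - p * R t i j)) t := by
    intro f p m i j hf0 hf hm
    refine ((hf.fun_inv hf0).fun_mul (hR i j)).congr_deriv ?_
    rw [hm]
    field_simp
    ring
  have hN : HasDerivAt (fun s => (a s * b s * c s)⁻¹) (-(a t * b t * c t)⁻¹ *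
      (α₁ t + α₂ t + α₃ t - (a t ^ 2 + b t ^ 2 + c t ^ 2) / 2)) t := by
    refine ((h.hasDerivAt_volume ht).fun_inv hN0).congr_deriv ?_
    field_simp
  fin_cases i <;> fin_cases j
  all_goals first
    | exact hasDerivAt_const t 0
    | exact key ha0 (h.hasDerivAt_a t ht) (h0 _)
    | exact key hb0 (h.hasDerivAt_b t ht) (h1 _)
    | exact key hc0 (h.hasDerivAt_c t ht) (h2 _)
    | exact hN

/-- The brackets of the orthonormal frame. -/
theorem bracket (h : IsRotatingFamily J a b c R ξ₁ ξ₂ ξ₃ α₁ α₂ α₃) {q : ℍ[ℝ]}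
    (hq : q ∈ region J) (i j : Fin 4) :
    fderiv ℝ (frame a b c R j) q (frame a b c R i q)
      - fderiv ℝ (frame a b c R i) q (frame a b c R j q) =
      ∑ k, frameStructure a b c ξ₁ ξ₂ ξ₃ α₁ α₂ α₃ i j k q • frame a b c R k q := by
  wlog hij : i < j generalizing i j
  · rcases (not_lt.mp hij).eq_or_lt with rfl | hlt
    · have hz : ∀ k, frameStructure a b c ξ₁ ξ₂ ξ₃ α₁ α₂ α₃ j j k q = 0 := fun k =>
        self_eq_neg.mp (structureFunction_antisymm ..)
      simp [hz]
    · rw [← neg_sub, this j i hlt, ← Finset.sum_neg_distrib]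
      refine Finset.sum_congr rfl fun k _ => ?_
      rw [← neg_smul]
      congr 1
      exact (structureFunction_antisymm ..).symm
  have ha0 := h.a_ne_zero _ hq.2
  have hb0 := h.b_ne_zero _ hq.2
  have hc0 := h.c_ne_zero _ hq.2
  have hadj := adjugate_of_mem_specialOrthogonalGroup (h.specialOrthogonal _ hq.2)
  rw [Matrix.adjugate_fin_three] at hadj
  have hcof := fun i j => (congrFun (congrFun hadj j) i).symm
  have hr := h.hasDerivAt_frameCoeff hq.2
  have hbr := bracket_sum_invariantField (r' := fun i j _ => _) hq.1 hr i j
  refine hbr.trans ?_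
  simp only [frame, Finset.smul_sum, smul_smul]
  rw [Finset.sum_comm]
  simp only [← Finset.sum_smul]
  refine Finset.sum_congr rfl fun k _ => ?_
  congr 1
  simp only [frameStructure, structureFunction, Fin.sum_univ_four, reducedXi]
  have c00 := hcof 0 0
  have c01 := hcof 0 1
  have c02 := hcof 0 2
  have c10 := hcof 1 0
  have c11 := hcof 1 1
  have c12 := hcof 1 2
  have c20 := hcof 2 0
  have c21 := hcof 2 1
  have c22 := hcof 2 2
  clear hbr hr
  simp at c00 c01 c02 c10 c11 c12 c20 c21 c22
  fin_cases i <;> fin_cases j <;> (try (exact absurd hij (by decide))) <;> fin_cases k <;>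
    simp [frameCoeff, invariantConst]
  all_goals field_simp
  all_goals first
    | ring1
    | linarith

end IsRotatingFamily

theorem differentiableAt_structureFunction {a b c x₁ x₂ x₃ α₁ α₂ α₃ : ℝ → ℝ} {t : ℝ}
    (ha : DifferentiableAt ℝ a t) (hb : DifferentiableAt ℝ b t) (hc : DifferentiableAt ℝ c t)
    (hx₁ : DifferentiableAt ℝ x₁ t) (hx₂ : DifferentiableAt ℝ x₂ t) (hx₃ : DifferentiableAt ℝ x₃ t)
    (hα₁ : DifferentiableAt ℝ α₁ t) (hα₂ : DifferentiableAt ℝ α₂ t) (hα₃ : DifferentiableAt ℝ α₃ t)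
    (h0 : a t * b t * c t ≠ 0) (i j k : Fin 4) :
    DifferentiableAt ℝ (structureFunction a b c x₁ x₂ x₃ α₁ α₂ α₃ i j k) t := by
  unfold structureFunction
  refine DifferentiableAt.fun_div ?_ (by fun_prop) h0
  fin_cases i <;> fin_cases j <;> fin_cases k <;> simp <;> fun_prop

namespace IsRotatingFamily

theorem volume_ne_zero (h : IsRotatingFamily J a b c R ξ₁ ξ₂ ξ₃ α₁ α₂ α₃) {t : ℝ} (ht : t ∈ J) :
    a t * b t * c t ≠ 0 :=
  mul_ne_zero (mul_ne_zero (h.a_ne_zero t ht) (h.b_ne_zero t ht)) (h.c_ne_zero t ht)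

theorem differentiableAt_reducedXi₁ (h : IsRotatingFamily J a b c R ξ₁ ξ₂ ξ₃ α₁ α₂ α₃) {t : ℝ}
    (ht : t ∈ J) : DifferentiableAt ℝ (reducedXi a b c ξ₁) t := by
  have ha0 := h.a_ne_zero t ht
  have hb0 := h.b_ne_zero t ht
  have hc0 := h.c_ne_zero t ht
  have ha := (h.hasDerivAt_a t ht).differentiableAt
  have hb := (h.hasDerivAt_b t ht).differentiableAt
  have hc := (h.hasDerivAt_c t ht).differentiableAt
  have := h.differentiableAt_ξ₁ t ht
  unfold reducedXi
  exact DifferentiableAt.fun_div this (by fun_prop) (by simp [ha0, hb0, hc0])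

theorem differentiableAt_reducedXi₂ (h : IsRotatingFamily J a b c R ξ₁ ξ₂ ξ₃ α₁ α₂ α₃) {t : ℝ}
    (ht : t ∈ J) : DifferentiableAt ℝ (reducedXi b c a ξ₂) t := by
  have ha0 := h.a_ne_zero t ht
  have hb0 := h.b_ne_zero t ht
  have hc0 := h.c_ne_zero t ht
  have ha := (h.hasDerivAt_a t ht).differentiableAt
  have hb := (h.hasDerivAt_b t ht).differentiableAt
  have hc := (h.hasDerivAt_c t ht).differentiableAt
  have := h.differentiableAt_ξ₂ t ht
  unfold reducedXi
  exact DifferentiableAt.fun_div this (by fun_prop) (by simp [ha0, hb0, hc0])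

theorem differentiableAt_reducedXi₃ (h : IsRotatingFamily J a b c R ξ₁ ξ₂ ξ₃ α₁ α₂ α₃) {t : ℝ}
    (ht : t ∈ J) : DifferentiableAt ℝ (reducedXi c a b ξ₃) t := by
  have ha0 := h.a_ne_zero t ht
  have hb0 := h.b_ne_zero t ht
  have hc0 := h.c_ne_zero t ht
  have ha := (h.hasDerivAt_a t ht).differentiableAt
  have hb := (h.hasDerivAt_b t ht).differentiableAt
  have hc := (h.hasDerivAt_c t ht).differentiableAt
  have := h.differentiableAt_ξ₃ t ht
  unfold reducedXi
  exact DifferentiableAt.fun_div this (by fun_prop) (by simp [ha0, hb0, hc0])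

theorem isFrameOn (h : IsRotatingFamily J a b c R ξ₁ ξ₂ ξ₃ α₁ α₂ α₃) :
    MetricTensor.IsFrameOn (metric a b c R) (frame a b c R)
      (frameStructure a b c ξ₁ ξ₂ ξ₃ α₁ α₂ α₃) (region J) where
  isOpen := isOpen_region h.isOpen
  symm := metric_symm a b c R
  contDiffOn_metric := h.contDiffOn_metric
  orthonormal _ hq := h.orthonormal hq
  finrank := Quaternion.finrank_eq_four
  contDiffOn := h.contDiffOn_frame
  bracket _ hq := h.bracket hq
  differentiableAt q hq i j k :=
    (differentiableAt_structureFunction (h.hasDerivAt_a _ hq.2).differentiableAt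
      (h.hasDerivAt_b _ hq.2).differentiableAt (h.hasDerivAt_c _ hq.2).differentiableAt
      (h.differentiableAt_reducedXi₁ hq.2) (h.differentiableAt_reducedXi₂ hq.2)
      (h.differentiableAt_reducedXi₃ hq.2) (h.differentiableAt_α₁ _ hq.2)
      (h.differentiableAt_α₂ _ hq.2) (h.differentiableAt_α₃ _ hq.2)
      (h.volume_ne_zero hq.2) i j k).comp q (differentiableAt_time hq.1)
  antisymm _ _ _ _ := structureFunction_antisymm ..

/-- The metric is anti-self-dual and scalar-flat if and only if the block `A` vanishes. -/
theorem isAntiSelfDualAt_and_scalarFlat_iff (h : IsRotatingFamily J a b c R ξ₁ ξ₂ ξ₃ α₁ α₂ α₃)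
    {q : ℍ[ℝ]} (hq : q ∈ region J) :
    (MetricTensor.IsAntiSelfDualAt (metric a b c R) (coframe q) q ∧
      MetricTensor.scalarCurvature (metric a b c R) q = 0) ↔ blockA a b c R q = 0 := by
  rw [blockA_eq]
  exact MetricTensor.isAntiSelfDualAt_and_scalarFlat_iff (h.orthonormal hq)
    Quaternion.finrank_eq_four (h.coframe_det_pos hq) (h.isFrameOn.isAlgebraicCurvature hq)

end IsRotatingFamily

/-- The numerators of the connection on self-dual bivectors in the orthonormal frame. -/
def connectionNumerator (a b c x₁ x₂ x₃ α₁ α₂ α₃ : ℝ → ℝ) : Fin 3 → Fin 4 → ℝ → ℝ :=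
  ![![α₁, fun t => x₃ t * (c t ^ 2 * (a t ^ 2 - b t ^ 2)) / 2,
      fun t => x₂ t * (b t ^ 2 * (c t ^ 2 - a t ^ 2)) / 2,
      fun t => -(x₁ t * (a t ^ 2 * (b t ^ 2 + c t ^ 2))) / 2],
    ![fun t => x₃ t * (c t ^ 2 * (a t ^ 2 - b t ^ 2)) / 2, α₂,
      fun t => x₁ t * (a t ^ 2 * (b t ^ 2 - c t ^ 2)) / 2,
      fun t => -(x₂ t * (b t ^ 2 * (c t ^ 2 + a t ^ 2))) / 2],
    ![fun t => x₂ t * (b t ^ 2 * (c t ^ 2 - a t ^ 2)) / 2,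
      fun t => x₁ t * (a t ^ 2 * (b t ^ 2 - c t ^ 2)) / 2, α₃,
      fun t => -(x₃ t * (c t ^ 2 * (a t ^ 2 + b t ^ 2))) / 2]]

theorem selfDualConnection_eq (j : Fin 3) (m : Fin 4) (q : ℍ[ℝ]) :
    MetricTensor.selfDualConnection (frameStructure a b c ξ₁ ξ₂ ξ₃ α₁ α₂ α₃) j m q =
      connectionNumerator a b c (reducedXi a b c ξ₁) (reducedXi b c a ξ₂) (reducedXi c a b ξ₃)
        α₁ α₂ α₃ j m (time q) / (a (time q) * b (time q) * c (time q)) := by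
  fin_cases j <;> fin_cases m <;>
    simp [MetricTensor.selfDualConnection, MetricTensor.connectionCoeff, frameStructure,
      structureFunction, connectionNumerator] <;> ring

/-- The derivatives of `connectionNumerator` in the orbit directions. -/
def connectionNumeratorDeriv (a b c x₁ x₂ x₃ α₁ α₂ α₃ : ℝ → ℝ) (t : ℝ) : Fin 3 → Fin 3 → ℝ :=
  let p₁ := α₁ t - (b t ^ 2 + c t ^ 2 - a t ^ 2) / 2
  let p₂ := α₂ t - (c t ^ 2 + a t ^ 2 - b t ^ 2) / 2
  let p₃ := α₃ t - (a t ^ 2 + b t ^ 2 - c t ^ 2) / 2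
  let d₁ := deriv x₁ t * (a t ^ 2 * (b t ^ 2 - c t ^ 2)) / 2
    + x₁ t * a t ^ 2 * (p₁ * (b t ^ 2 - c t ^ 2) + p₂ * b t ^ 2 - p₃ * c t ^ 2)
  let d₂ := deriv x₂ t * (b t ^ 2 * (c t ^ 2 - a t ^ 2)) / 2
    + x₂ t * b t ^ 2 * (p₂ * (c t ^ 2 - a t ^ 2) + p₃ * c t ^ 2 - p₁ * a t ^ 2)
  let d₃ := deriv x₃ t * (c t ^ 2 * (a t ^ 2 - b t ^ 2)) / 2
    + x₃ t * c t ^ 2 * (p₃ * (a t ^ 2 - b t ^ 2) + p₁ * a t ^ 2 - p₂ * b t ^ 2)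
  ![![deriv α₁ t, d₃, d₂], ![d₃, deriv α₂ t, d₁], ![d₂, d₁, deriv α₃ t]]

theorem hasDerivAt_offDiagonal {a b c x : ℝ → ℝ} {t p₁ p₂ p₃ : ℝ}
    (ha : HasDerivAt a (a t * p₁) t) (hb : HasDerivAt b (b t * p₂) t)
    (hc : HasDerivAt c (c t * p₃) t) (hx : DifferentiableAt ℝ x t) :
    HasDerivAt (fun t => x t * (a t ^ 2 * (b t ^ 2 - c t ^ 2)) / 2)
      (deriv x t * (a t ^ 2 * (b t ^ 2 - c t ^ 2)) / 2
        + x t * a t ^ 2 * (p₁ * (b t ^ 2 - c t ^ 2) + p₂ * b t ^ 2 - p₃ * c t ^ 2)) t := by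
  refine ((hx.hasDerivAt.fun_mul ((ha.fun_pow 2).fun_mul
    ((hb.fun_pow 2).fun_sub (hc.fun_pow 2)))).div_const 2).congr_deriv ?_
  push_cast
  ring

namespace IsRotatingFamily

theorem hasDerivAt_connectionNumerator (h : IsRotatingFamily J a b c R ξ₁ ξ₂ ξ₃ α₁ α₂ α₃)
    {x₁ x₂ x₃ : ℝ → ℝ} {t : ℝ} (ht : t ∈ J) (hx₁ : DifferentiableAt ℝ x₁ t)
    (hx₂ : DifferentiableAt ℝ x₂ t) (hx₃ : DifferentiableAt ℝ x₃ t) (j i : Fin 3) :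
    HasDerivAt (connectionNumerator a b c x₁ x₂ x₃ α₁ α₂ α₃ j i.castSucc)
      (connectionNumeratorDeriv a b c x₁ x₂ x₃ α₁ α₂ α₃ t j i) t := by
  have d₁ := hasDerivAt_offDiagonal (h.hasDerivAt_a t ht) (h.hasDerivAt_b t ht)
    (h.hasDerivAt_c t ht) hx₁
  have d₂ := hasDerivAt_offDiagonal (h.hasDerivAt_b t ht) (h.hasDerivAt_c t ht)
    (h.hasDerivAt_a t ht) hx₂
  have d₃ := hasDerivAt_offDiagonal (h.hasDerivAt_c t ht) (h.hasDerivAt_a t ht)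
    (h.hasDerivAt_b t ht) hx₃
  fin_cases j <;> fin_cases i
  · exact (h.differentiableAt_α₁ t ht).hasDerivAt
  · exact d₃
  · exact d₂
  · exact d₃
  · exact (h.differentiableAt_α₂ t ht).hasDerivAt
  · exact d₁
  · exact d₂
  · exact d₁
  · exact (h.differentiableAt_α₃ t ht).hasDerivAt

/-- The frame derivatives of the orbit components of the connection on self-dual bivectors. -/
theorem fderiv_selfDualConnection (h : IsRotatingFamily J a b c R ξ₁ ξ₂ ξ₃ α₁ α₂ α₃) {q : ℍ[ℝ]}
    (hq : q ∈ region J) (j i : Fin 3) (m : Fin 4) :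
    fderiv ℝ (MetricTensor.selfDualConnection (frameStructure a b c ξ₁ ξ₂ ξ₃ α₁ α₂ α₃) j
        i.castSucc) q (frame a b c R m q) =
      frameCoeff a b c R m 3 (time q) *
        ((connectionNumeratorDeriv a b c (reducedXi a b c ξ₁) (reducedXi b c a ξ₂)
          (reducedXi c a b ξ₃) α₁ α₂ α₃ (time q) j i
        - connectionNumerator a b c (reducedXi a b c ξ₁) (reducedXi b c a ξ₂)
          (reducedXi c a b ξ₃) α₁ α₂ α₃ j i.castSucc (time q) *
          (α₁ (time q) + α₂ (time q) + α₃ (time q)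
            - (a (time q) ^ 2 + b (time q) ^ 2 + c (time q) ^ 2) / 2))
        / (a (time q) * b (time q) * c (time q))) := by
  have hN0 := h.volume_ne_zero hq.2
  have hd := (h.hasDerivAt_connectionNumerator hq.2 (h.differentiableAt_reducedXi₁ hq.2)
    (h.differentiableAt_reducedXi₂ hq.2) (h.differentiableAt_reducedXi₃ hq.2) j i).fun_div
    (h.hasDerivAt_volume hq.2) hN0
  rw [funext (selfDualConnection_eq j i.castSucc), (hasFDerivAt_comp_time hq.1 hd).fderiv,
    smul_apply, dt_frame hq.1, smul_eq_mul, mul_comm]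
  congr 1
  field_simp

end IsRotatingFamily

/-- The defect of the evolution equation of `α₁`. -/
def alphaDefect (a b c x₁ x₂ x₃ α₁ α₂ α₃ : ℝ → ℝ) (t : ℝ) : ℝ :=
  deriv α₁ t - (-(α₂ t * α₃ t) + α₁ t * (α₂ t + α₃ t)
    + 1 / 4 * ((c t * a t) ^ 2 - (a t * b t) ^ 2) ^ 2 * x₁ t ^ 2
    + 1 / 4 * ((a t * b t) ^ 2 - (b t * c t) ^ 2) * (3 * (b t * c t) ^ 2 + (a t * b t) ^ 2)
        * x₂ t ^ 2
    + 1 / 4 * ((c t * a t) ^ 2 - (b t * c t) ^ 2) * (3 * (b t * c t) ^ 2 + (c t * a t) ^ 2)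
        * x₃ t ^ 2)

/-- The defect of the evolution equation of `ξ₁`. -/
def xiDefect (a b c x₁ x₂ x₃ α₂ α₃ : ℝ → ℝ) (t : ℝ) : ℝ :=
  ((c t * a t) ^ 2 - (a t * b t) ^ 2) * deriv x₁ t
    - (x₂ t * x₃ t * (-2 * (c t * a t) ^ 2 * (a t * b t) ^ 2 + (a t * b t) ^ 2 * (b t * c t) ^ 2
        + (b t * c t) ^ 2 * (c t * a t) ^ 2)
      + x₁ t * (α₂ t * (c t * a t) ^ 2 - α₃ t * (a t * b t) ^ 2 + 3 * α₂ t * (a t * b t) ^ 2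
        - 3 * α₃ t * (c t * a t) ^ 2))

theorem differentiableAt_connectionNumerator_three {x₁ x₂ x₃ : ℝ → ℝ} {t : ℝ}
    (ha : DifferentiableAt ℝ a t) (hb : DifferentiableAt ℝ b t) (hc : DifferentiableAt ℝ c t)
    (hx₁ : DifferentiableAt ℝ x₁ t) (hx₂ : DifferentiableAt ℝ x₂ t) (hx₃ : DifferentiableAt ℝ x₃ t)
    (j : Fin 3) :
    DifferentiableAt ℝ (connectionNumerator a b c x₁ x₂ x₃ α₁ α₂ α₃ j 3) t := by
  unfold connectionNumerator
  fin_cases j <;> simp <;> fun_prop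

theorem frameCoeff_castSucc_three (i : Fin 3) (t : ℝ) : frameCoeff a b c R i.castSucc 3 t = 0 := by
  fin_cases i <;> rfl

theorem frameCoeff_three_three (t : ℝ) : frameCoeff a b c R 3 3 t = (a t * b t * c t)⁻¹ := rfl

namespace IsRotatingFamily

theorem fderiv_selfDualConnection_three (h : IsRotatingFamily J a b c R ξ₁ ξ₂ ξ₃ α₁ α₂ α₃)
    {q : ℍ[ℝ]} (hq : q ∈ region J) (j i : Fin 3) :
    fderiv ℝ (MetricTensor.selfDualConnection (frameStructure a b c ξ₁ ξ₂ ξ₃ α₁ α₂ α₃) j 3) q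
      (frame a b c R i.castSucc q) = 0 := by
  have hd := (differentiableAt_connectionNumerator_three (α₁ := α₁) (α₂ := α₂) (α₃ := α₃)
    (h.hasDerivAt_a _ hq.2).differentiableAt (h.hasDerivAt_b _ hq.2).differentiableAt
    (h.hasDerivAt_c _ hq.2).differentiableAt (h.differentiableAt_reducedXi₁ hq.2)
    (h.differentiableAt_reducedXi₂ hq.2) (h.differentiableAt_reducedXi₃ hq.2)
    j).hasDerivAt.fun_div (h.hasDerivAt_volume hq.2) (h.volume_ne_zero hq.2)
  rw [funext (selfDualConnection_eq j 3), (hasFDerivAt_comp_time hq.1 hd).fderiv, smul_apply,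
    dt_frame hq.1, frameCoeff_castSucc_three, smul_zero]

/-- The block `A` in terms of the defects of the evolution equations. -/
theorem selfDualComp_eq (h : IsRotatingFamily J a b c R ξ₁ ξ₂ ξ₃ α₁ α₂ α₃)
    {q : ℍ[ℝ]} (hq : q ∈ region J) {x₁ x₂ x₃ : ℝ → ℝ} (hx₁ : reducedXi a b c ξ₁ = x₁)
    (hx₂ : reducedXi b c a ξ₂ = x₂) (hx₃ : reducedXi c a b ξ₃ = x₃) (i j : Fin 3) :
    MetricTensor.selfDualComp
        (MetricTensor.riemannComp (metric a b c R) (frame a b c R) q) i j =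
      (!![-alphaDefect a b c x₁ x₂ x₃ α₁ α₂ α₃ (time q), xiDefect c a b x₃ x₁ x₂ α₁ α₂ (time q) / 2,
          xiDefect b c a x₂ x₃ x₁ α₃ α₁ (time q) / 2;
        xiDefect c a b x₃ x₁ x₂ α₁ α₂ (time q) / 2, -alphaDefect b c a x₂ x₃ x₁ α₂ α₃ α₁ (time q),
          xiDefect a b c x₁ x₂ x₃ α₂ α₃ (time q) / 2;
        xiDefect b c a x₂ x₃ x₁ α₃ α₁ (time q) / 2, xiDefect a b c x₁ x₂ x₃ α₂ α₃ (time q) / 2,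
          -alphaDefect c a b x₃ x₁ x₂ α₃ α₁ α₂ (time q)] : Matrix (Fin 3) (Fin 3) ℝ) i j
        / (a (time q) * b (time q) * c (time q)) ^ 2 := by
  have ha0 := h.a_ne_zero _ hq.2
  have hb0 := h.b_ne_zero _ hq.2
  have hc0 := h.c_ne_zero _ hq.2
  rw [h.isFrameOn.selfDualComp_riemannComp hq, MetricTensor.selfDualCurvature,
    MetricTensor.selfDualCurvature, h.fderiv_selfDualConnection hq, h.fderiv_selfDualConnection hq,
    h.fderiv_selfDualConnection hq, h.fderiv_selfDualConnection_three hq]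
  simp only [frameCoeff_castSucc_three, frameCoeff_three_three, selfDualConnection_eq,
    frameStructure, hx₁, hx₂, hx₃, zero_mul, sub_zero, zero_sub, zero_add, Fin.sum_univ_four]
  clear hx₁ hx₂ hx₃
  fin_cases i <;> fin_cases j <;>
    simp [connectionNumerator, connectionNumeratorDeriv, structureFunction, alphaDefect,
      xiDefect]
  all_goals field_simp
  all_goals ring

end IsRotatingFamily

/-- The block `A` vanishes if and only if the evolution equations hold. -/
theorem IsRotatingFamily.blockA_eq_zero_iff {J : Set ℝ} {a b c : ℝ → ℝ}
    {R : ℝ → Matrix (Fin 3) (Fin 3) ℝ} {ξ₁ ξ₂ ξ₃ α₁ α₂ α₃ : ℝ → ℝ}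
    (h : IsRotatingFamily J a b c R ξ₁ ξ₂ ξ₃ α₁ α₂ α₃) {w₁ w₂ w₃ : ℝ → ℝ}
    (hw₁ : w₁ = fun t => b t * c t) (hw₂ : w₂ = fun t => c t * a t)
    (hw₃ : w₃ = fun t => a t * b t) {q : ℍ[ℝ]} (hq : q ∈ region J) :
    blockA a b c R q = 0 ↔
      (AlphaEvolution w₁ w₂ w₃ α₁ α₂ α₃ ξ₁ ξ₂ ξ₃ (time q) ∧
        AlphaEvolution w₂ w₃ w₁ α₂ α₃ α₁ ξ₂ ξ₃ ξ₁ (time q) ∧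
        AlphaEvolution w₃ w₁ w₂ α₃ α₁ α₂ ξ₃ ξ₁ ξ₂ (time q)) ∧
      (XiEvolution w₁ w₂ w₃ α₂ α₃ ξ₁ ξ₂ ξ₃ (time q) ∧
        XiEvolution w₂ w₃ w₁ α₃ α₁ ξ₂ ξ₃ ξ₁ (time q) ∧
        XiEvolution w₃ w₁ w₂ α₁ α₂ ξ₃ ξ₁ ξ₂ (time q)) := by
  subst hw₁ hw₂ hw₃
  have hN : (a (time q) * b (time q) * c (time q)) ^ 2 ≠ 0 := pow_ne_zero 2 (h.volume_ne_zero hq.2)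
  rw [blockA_eq, MetricTensor.selfDualBlock_eq_zero_iff]
  simp only [h.selfDualComp_eq hq rfl rfl rfl, div_eq_zero_iff, hN, or_false]
  have e₁ : AlphaEvolution (fun t => b t * c t) (fun t => c t * a t) (fun t => a t * b t)
      α₁ α₂ α₃ ξ₁ ξ₂ ξ₃ (time q) ↔ alphaDefect a b c (reducedXi a b c ξ₁) (reducedXi b c a ξ₂)
        (reducedXi c a b ξ₃) α₁ α₂ α₃ (time q) = 0 := sub_eq_zero.symm
  have e₂ : AlphaEvolution (fun t => c t * a t) (fun t => a t * b t) (fun t => b t * c t)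
      α₂ α₃ α₁ ξ₂ ξ₃ ξ₁ (time q) ↔ alphaDefect b c a (reducedXi b c a ξ₂) (reducedXi c a b ξ₃)
        (reducedXi a b c ξ₁) α₂ α₃ α₁ (time q) = 0 := sub_eq_zero.symm
  have e₃ : AlphaEvolution (fun t => a t * b t) (fun t => b t * c t) (fun t => c t * a t)
      α₃ α₁ α₂ ξ₃ ξ₁ ξ₂ (time q) ↔ alphaDefect c a b (reducedXi c a b ξ₃) (reducedXi a b c ξ₁)
        (reducedXi b c a ξ₂) α₃ α₁ α₂ (time q) = 0 := sub_eq_zero.symm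
  have x₁ : XiEvolution (fun t => b t * c t) (fun t => c t * a t) (fun t => a t * b t)
      α₂ α₃ ξ₁ ξ₂ ξ₃ (time q) ↔ xiDefect a b c (reducedXi a b c ξ₁) (reducedXi b c a ξ₂)
        (reducedXi c a b ξ₃) α₂ α₃ (time q) = 0 := sub_eq_zero.symm
  have x₂ : XiEvolution (fun t => c t * a t) (fun t => a t * b t) (fun t => b t * c t)
      α₃ α₁ ξ₂ ξ₃ ξ₁ (time q) ↔ xiDefect b c a (reducedXi b c a ξ₂) (reducedXi c a b ξ₃)
        (reducedXi a b c ξ₁) α₃ α₁ (time q) = 0 := sub_eq_zero.symm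
  have x₃ : XiEvolution (fun t => a t * b t) (fun t => b t * c t) (fun t => c t * a t)
      α₁ α₂ ξ₃ ξ₁ ξ₂ (time q) ↔ xiDefect c a b (reducedXi c a b ξ₃) (reducedXi a b c ξ₁)
        (reducedXi b c a ξ₂) α₁ α₂ (time q) = 0 := sub_eq_zero.symm
  rw [e₁, e₂, e₃, x₁, x₂, x₃]
  simp [Fin.forall_fin_succ]
  tauto

/-- The equations for `ẇᵢ` determine the logarithmic derivative of `a`. -/
theorem deriv_eq_of_alphaEq {a b c α₁ α₂ α₃ : ℝ → ℝ} {t : ℝ}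
    (ha : DifferentiableAt ℝ a t) (hb : DifferentiableAt ℝ b t) (hc : DifferentiableAt ℝ c t)
    (hb0 : b t ≠ 0) (hc0 : c t ≠ 0)
    (h₁ : AlphaEq (fun t => b t * c t) (fun t => c t * a t) (fun t => a t * b t) α₂ α₃ t)
    (h₂ : AlphaEq (fun t => c t * a t) (fun t => a t * b t) (fun t => b t * c t) α₃ α₁ t)
    (h₃ : AlphaEq (fun t => a t * b t) (fun t => b t * c t) (fun t => c t * a t) α₁ α₂ t) :
    deriv a t = a t * (α₁ t - (b t ^ 2 + c t ^ 2 - a t ^ 2) / 2) := by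
  simp only [AlphaEq] at h₁ h₂ h₃
  rw [deriv_fun_mul hb hc] at h₁
  rw [deriv_fun_mul hc ha] at h₂
  rw [deriv_fun_mul ha hb] at h₃
  have h0 : 2 * (b t * c t) ≠ 0 := by simp [hb0, hc0]
  refine mul_left_cancel₀ h0 ?_
  linear_combination b t * h₂ + c t * h₃ - a t * h₁

theorem isRotatingFamily_of_alphaEq {J : Set ℝ} (hJ : IsOpen J) {a b c : ℝ → ℝ}
    {R : ℝ → Matrix (Fin 3) (Fin 3) ℝ}
    (ha : ContDiffOn ℝ ∞ a J) (hb : ContDiffOn ℝ ∞ b J) (hc : ContDiffOn ℝ ∞ c J)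
    (ha0 : ∀ t ∈ J, a t ≠ 0) (hb0 : ∀ t ∈ J, b t ≠ 0) (hc0 : ∀ t ∈ J, c t ≠ 0)
    (hR : ∀ i j, ContDiffOn ℝ ∞ (fun t => R t i j) J)
    (hRSO : ∀ t ∈ J, R t ∈ Matrix.specialOrthogonalGroup (Fin 3) ℝ)
    {ξ₁ ξ₂ ξ₃ : ℝ → ℝ}
    (hξ : ∀ t ∈ J, (Matrix.of fun i j => deriv (fun s => R s i j) t) * (R t)⁻¹ =
      rotationMatrix (ξ₁ t) (ξ₂ t) (ξ₃ t))
    {α₁ α₂ α₃ : ℝ → ℝ}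
    (h₁ : ∀ t ∈ J,
      AlphaEq (fun t => b t * c t) (fun t => c t * a t) (fun t => a t * b t) α₂ α₃ t)
    (h₂ : ∀ t ∈ J,
      AlphaEq (fun t => c t * a t) (fun t => a t * b t) (fun t => b t * c t) α₃ α₁ t)
    (h₃ : ∀ t ∈ J,
      AlphaEq (fun t => a t * b t) (fun t => b t * c t) (fun t => c t * a t) α₁ α₂ t) :
    IsRotatingFamily J a b c R ξ₁ ξ₂ ξ₃ α₁ α₂ α₃ := by
  have hd : ∀ {f : ℝ → ℝ}, ContDiffOn ℝ ∞ f J → ∀ t ∈ J, DifferentiableAt ℝ f t :=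
    fun hf t ht => (hf.contDiffAt (hJ.mem_nhds ht)).differentiableAt (by simp)
  have hdd : ∀ {f : ℝ → ℝ}, ContDiffOn ℝ ∞ f J → ∀ t ∈ J, DifferentiableAt ℝ (deriv f) t :=
    fun hf t ht => hd ((contDiffOn_infty_iff_deriv_of_isOpen hJ).mp hf).2 t ht
  have da : ∀ t ∈ J, deriv a t = a t * (α₁ t - (b t ^ 2 + c t ^ 2 - a t ^ 2) / 2) := fun t ht =>
    deriv_eq_of_alphaEq (hd ha t ht) (hd hb t ht) (hd hc t ht) (hb0 t ht) (hc0 t ht)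
      (h₁ t ht) (h₂ t ht) (h₃ t ht)
  have db : ∀ t ∈ J, deriv b t = b t * (α₂ t - (c t ^ 2 + a t ^ 2 - b t ^ 2) / 2) := fun t ht =>
    deriv_eq_of_alphaEq (hd hb t ht) (hd hc t ht) (hd ha t ht) (hc0 t ht) (ha0 t ht)
      (h₂ t ht) (h₃ t ht) (h₁ t ht)
  have dc : ∀ t ∈ J, deriv c t = c t * (α₃ t - (a t ^ 2 + b t ^ 2 - c t ^ 2) / 2) := fun t ht =>
    deriv_eq_of_alphaEq (hd hc t ht) (hd ha t ht) (hd hb t ht) (ha0 t ht) (hb0 t ht)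
      (h₃ t ht) (h₁ t ht) (h₂ t ht)
  have dα : ∀ {f p s α : ℝ → ℝ}, ContDiffOn ℝ ∞ f J → ContDiffOn ℝ ∞ p J → ContDiffOn ℝ ∞ s J →
      (∀ t ∈ J, f t ≠ 0) →
      (∀ t ∈ J, deriv f t = f t * (α t - (p t ^ 2 + s t ^ 2 - f t ^ 2) / 2)) →
      ∀ t ∈ J, DifferentiableAt ℝ α t := by
    intro f p s α hf hp hs hf0 h t ht
    have heq : α =ᶠ[nhds t] fun y => deriv f y / f y + (p y ^ 2 + s y ^ 2 - f y ^ 2) / 2 := by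
      filter_upwards [hJ.mem_nhds ht] with y hy
      rw [h y hy, mul_div_cancel_left₀ _ (hf0 y hy)]
      ring
    have d1 := hd hf t ht
    have d2 := hd hp t ht
    have d3 := hd hs t ht
    exact (((hdd hf t ht).fun_div d1 (hf0 t ht)).fun_add
      (by fun_prop)).congr_of_eventuallyEq heq
  have hX : ∀ t ∈ J, (Matrix.of fun i j => deriv (fun s => R s i j) t) =
      rotationMatrix (ξ₁ t) (ξ₂ t) (ξ₃ t) * R t := by
    intro t ht
    have hdet : IsUnit (R t).det := by
      rw [(Matrix.mem_specialOrthogonalGroup_iff.mp (hRSO t ht)).2]; exact isUnit_one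
    rw [← hξ t ht, mul_assoc, Matrix.nonsing_inv_mul _ hdet, mul_one]
  have dξ : ∀ {ξ : ℝ → ℝ} (i k : Fin 3),
      (∀ t ∈ J, ξ t = rotationMatrix (ξ₁ t) (ξ₂ t) (ξ₃ t) i k) →
      ∀ t ∈ J, DifferentiableAt ℝ ξ t := by
    intro ξ i k h t ht
    have heq : ξ =ᶠ[nhds t] fun y => ∑ j, deriv (fun s => R s i j) y * R y k j := by
      filter_upwards [hJ.mem_nhds ht] with y hy
      have hinv : (R y)⁻¹ = (R y).transpose := by
        refine Matrix.inv_eq_right_inv ?_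
        ext i k
        rw [Matrix.mul_apply, Matrix.one_apply, ← row_orthonormal (hRSO y hy) i k]
        rfl
      rw [h y hy, ← hξ y hy, hinv, Matrix.mul_apply]
      rfl
    refine DifferentiableAt.congr_of_eventuallyEq ?_ heq
    exact DifferentiableAt.fun_sum fun j _ => (hdd (hR i j) t ht).fun_mul (hd (hR k j) t ht)
  exact
    { isOpen := hJ
      contDiffOn_a := ha
      contDiffOn_b := hb
      contDiffOn_c := hc
      contDiffOn_R := hR
      a_ne_zero := ha0
      b_ne_zero := hb0
      c_ne_zero := hc0
      specialOrthogonal := hRSO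
      hasDerivAt_a := fun t ht => da t ht ▸ (hd ha t ht).hasDerivAt
      hasDerivAt_b := fun t ht => db t ht ▸ (hd hb t ht).hasDerivAt
      hasDerivAt_c := fun t ht => dc t ht ▸ (hd hc t ht).hasDerivAt
      hasDerivAt_R := fun t ht i j =>
        (hd (hR i j) t ht).hasDerivAt.congr_deriv (congrFun (congrFun (hX t ht) i) j)
      differentiableAt_ξ₁ := dξ 1 2 fun _ _ => rfl
      differentiableAt_ξ₂ := dξ 2 0 fun _ _ => rfl
      differentiableAt_ξ₃ := dξ 0 1 fun _ _ => rfl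
      differentiableAt_α₁ := dα ha hb hc ha0 da
      differentiableAt_α₂ := dα hb hc ha hb0 db
      differentiableAt_α₃ := dα hc ha hb hc0 dc }

end SU2Metric

end

theorem theorem2p1
    (J : Set ℝ) (hJ : IsOpen J)
    (a b c : ℝ → ℝ) (R : ℝ → Matrix (Fin 3) (Fin 3) ℝ)
    (ha : ContDiffOn ℝ ∞ a J) (hb : ContDiffOn ℝ ∞ b J) (hc : ContDiffOn ℝ ∞ c J)
    (ha0 : ∀ t ∈ J, a t ≠ 0) (hb0 : ∀ t ∈ J, b t ≠ 0) (hc0 : ∀ t ∈ J, c t ≠ 0)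
    (hR : ∀ i j, ContDiffOn ℝ ∞ (fun t => R t i j) J)
    (hRSO : ∀ t ∈ J, R t ∈ Matrix.specialOrthogonalGroup (Fin 3) ℝ)
    (ξ₁ ξ₂ ξ₃ : ℝ → ℝ)
    (hξ : ∀ t ∈ J, (Matrix.of fun i j => deriv (fun s => R s i j) t) * (R t)⁻¹ =
      SU2Metric.rotationMatrix (ξ₁ t) (ξ₂ t) (ξ₃ t))
    (w₁ w₂ w₃ : ℝ → ℝ)
    (hw₁ : ∀ t, w₁ t = b t * c t) (hw₂ : ∀ t, w₂ t = c t * a t) (hw₃ : ∀ t, w₃ t = a t * b t)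
    (α₁ α₂ α₃ : ℝ → ℝ)
    (hα₁ : ∀ t ∈ J, SU2Metric.AlphaEq w₁ w₂ w₃ α₂ α₃ t)
    (hα₂ : ∀ t ∈ J, SU2Metric.AlphaEq w₂ w₃ w₁ α₃ α₁ t)
    (hα₃ : ∀ t ∈ J, SU2Metric.AlphaEq w₃ w₁ w₂ α₁ α₂ t) :
    ((∀ q ∈ SU2Metric.region J,
        MetricTensor.IsAntiSelfDualAt (SU2Metric.metric a b c R) (SU2Metric.coframe q) q ∧
        MetricTensor.scalarCurvature (SU2Metric.metric a b c R) q = 0) ↔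
      ∀ t ∈ J,
        (SU2Metric.AlphaEvolution w₁ w₂ w₃ α₁ α₂ α₃ ξ₁ ξ₂ ξ₃ t ∧
          SU2Metric.AlphaEvolution w₂ w₃ w₁ α₂ α₃ α₁ ξ₂ ξ₃ ξ₁ t ∧
          SU2Metric.AlphaEvolution w₃ w₁ w₂ α₃ α₁ α₂ ξ₃ ξ₁ ξ₂ t) ∧
        (SU2Metric.XiEvolution w₁ w₂ w₃ α₂ α₃ ξ₁ ξ₂ ξ₃ t ∧
          SU2Metric.XiEvolution w₂ w₃ w₁ α₃ α₁ ξ₂ ξ₃ ξ₁ t ∧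
          SU2Metric.XiEvolution w₃ w₁ w₂ α₁ α₂ ξ₃ ξ₁ ξ₂ t)) ∧
    ((∀ q ∈ SU2Metric.region J,
        MetricTensor.IsAntiSelfDualAt (SU2Metric.metric a b c R) (SU2Metric.coframe q) q ∧
        MetricTensor.scalarCurvature (SU2Metric.metric a b c R) q = 0) ↔
      ∀ q ∈ SU2Metric.region J, SU2Metric.blockA a b c R q = 0) := by
  obtain rfl : w₁ = fun t => b t * c t := funext hw₁
  obtain rfl : w₂ = fun t => c t * a t := funext hw₂
  obtain rfl : w₃ = fun t => a t * b t := funext hw₃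
  have h := SU2Metric.isRotatingFamily_of_alphaEq hJ ha hb hc ha0 hb0 hc0 hR hRSO hξ hα₁ hα₂ hα₃
  have hA : (∀ q ∈ SU2Metric.region J,
        MetricTensor.IsAntiSelfDualAt (SU2Metric.metric a b c R) (SU2Metric.coframe q) q ∧
        MetricTensor.scalarCurvature (SU2Metric.metric a b c R) q = 0) ↔
      ∀ q ∈ SU2Metric.region J, SU2Metric.blockA a b c R q = 0 :=
    forall₂_congr fun q hq => h.isAntiSelfDualAt_and_scalarFlat_iff hq
  refine ⟨hA.trans ⟨fun hz t ht => ?_, fun he q hq => ?_⟩, hA⟩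
  · obtain ⟨q, hq, rfl⟩ := SU2Metric.exists_mem_region ht
    exact (h.blockA_eq_zero_iff rfl rfl rfl hq).mp (hz q hq)
  · exact (h.blockA_eq_zero_iff rfl rfl rfl hq).mpr (he _ hq.2)
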